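/- Let $G=(V,E)$ be an infinite connected simple graph, and write $G$ also for its 1-complex: every edge is a copy of $[0,1]$, and a set is open iff its trace on every closed edge is open. Let $\beta G$ be its Stone–Čech compactification, let $\overline{A}$ denote the closure in $\beta G$, and let $G^*=\beta G\setminus G$. For a vertex $v$ let $O_{\beta G}(v)=\overline{E(v)}\setminus\overline{N(v)}$, where $E(v)$ is the union of the closed edges at $v$ and $N(v)$ is the set of neighbours of $v$; the auxiliary remainder is $G^\times=\beta G\setminus\bigcup_{v\in V}O_{\beta G}(v)$. A (finite-order oriented) separation is a pair $(A,B)$ with $A\cup B=V$, $A\cap B$ finite and no edge between $A\setminus B$ and $B\setminus A$; put $(A,B)\le(C,D)$ iff $A\subseteq C$ and $B\supseteq D$. An $\aleph_0$-tangle $\tau$ of $G$ is a set of separations that contains precisely one of $(A,B),(B,A)$ for every separation $(A,B)$, that contains no two distinct $(B,A),(C,D)$ with $(A,B)<(C,D)$, and that has no finite subset $\sigma$ with $\bigcap_{(A,B)\in\sigma}B$ finite in which every two distinct elements $(A,B),(D,C)$ satisfy $(A,B)\le(C,D)$. For a finite $X\subseteq V$ let $\mathcal C_X$ be the set of components of $G-X$,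 and for $\mathcal C\subseteq\mathcal C_X$ let $V[\mathcal C]$ be the union of the vertex sets of the components in $\mathcal C$. Let $\Gamma$ be the set of all pairs $\gamma=(X,P)$ with $X\subseteq V$ finite and $P$ a finite partition of $\mathcal C_X$ into non-empty classes, and let $\Gamma'$ be the set of those $(X,P)\in\Gamma$ for which $V[\mathcal C]$ is infinite for all $\mathcal C\in P$. For an $\aleph_0$-tangle $\tau$ and $\gamma=(X,P)\in\Gamma$ let $\mathcal C(\tau,\gamma)$ be the unique $\mathcal C\in P$ with $(V\setminus V[\mathcal C],\,X\cup V[\mathcal C])\in\tau$, and let $G[\tau,\gamma]$ be the subgraph of $G$ induced by $X\cup V[\mathcal C(\tau,\gamma)]$. We write $\overline{\mathcal C}$ for $\overline{\bigcup\mathcal C}$. A component $K$ of $G^\times$ corresponds to $\tau$ if, for every $\gamma=(X,P)\in\Gamma$ and every $x\in K$, the class $\mathcal C(\tau,\gamma)$ is the unique $\mathcal C\in P$ with $x\in\overline{\mathcal C}$. A component of $G^*$ corresponds to $\tau$ if it includes a component of $G^\times$ that corresponds to $\tau$. **Theorem 5.24.** These are one-to-one correspondences between the $\aleph_0$-tangles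 of $G$ and the components of $G^\times$, and between the $\aleph_0$-tangles of $G$ and the components of $G^*$. If $\tau$ is an $\aleph_0$-tangle of $G$, and $\tau_*$ and $\tau_\times$ are the components of $G^*$ and $G^\times$ corresponding to $\tau$, then (i) $\tau_*=G^*\cap\bigcap_{\gamma\in\Gamma}\overline{G[\tau,\gamma]}$, and (ii) $\tau_\times=\bigcap_{\gamma\in\Gamma}\overline{\mathcal C(\tau,\gamma)}=G^\times\cap\bigcap_{\gamma\in\Gamma}\overline{G[\tau,\gamma]}=\tau_*\cap G^\times$. The same holds with $\Gamma'$ in place of $\Gamma$ in the intersections of (i) and (ii). -/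

import Mathlib

universe u

namespace StoneTangle

variable {V : Type u}

/-! ## The 1-complex of a graph -/

/-- The point with barycentric coordinates `1 - t` at `v` and `t` at `w`. -/
noncomputable def edgeCoord (v w : V) (t : ℝ) : V →₀ ℝ :=
  Finsupp.single v (1 - t) + Finsupp.single w t

/-- The point set of the 1-complex of `G`, in barycentric coordinates: the vertices, and the
points `(1 - t) v + t w` of the edges `vw`, `0 ≤ t ≤ 1`. (The two directions of an edge give the
same points, and the points with `t = 0` or `t = 1` are the end vertices.) -/
def OneComplex (G : SimpleGraph V) : Type u :=
  {f : V →₀ ℝ // (∃ v, f = Finsupp.single v 1) ∨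
    ∃ v w, G.Adj v w ∧ ∃ t ∈ Set.Icc (0 : ℝ) 1, f = edgeCoord v w t}

/-- The set of vertices with non-zero coordinate: `{v}` at the vertex `v`, and `{v, w}` at the
inner points of the edge `vw`. -/
def OneComplex.supp {G : SimpleGraph V} (p : OneComplex G) : Set V := {v | p.1 v ≠ 0}

/-- The vertex `v` as a point of the 1-complex. -/
noncomputable def vertexPoint (G : SimpleGraph V) (v : V) : OneComplex G :=
  ⟨Finsupp.single v 1, Or.inl ⟨v, rfl⟩⟩

/-- The parametrisation of the closed edge underlying a directed edge `d` by `[0, 1]`. -/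
noncomputable def edgeMap (G : SimpleGraph V) (d : G.Dart) (t : unitInterval) : OneComplex G :=
  ⟨edgeCoord d.fst d.snd t, Or.inr ⟨d.fst, d.snd, d.adj, t, t.2, rfl⟩⟩

/-- The topology of the 1-complex: a set is open iff its trace on every closed edge is open (see
`isOpen_iff`). So the edges are copies of `[0, 1]`, and the basic open neighbourhoods of a vertex
`v` are the unions of half-open intervals `[v, i_e)`, one for each edge `e` at `v`, where the
points `i_e` are chosen independently of each other. -/
noncomputable instance oneComplexTopology (G : SimpleGraph V) : TopologicalSpace (OneComplex G) :=
  ⨆ d : G.Dart, TopologicalSpace.coinduced (edgeMap G d) inferInstance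

theorem isOpen_iff {G : SimpleGraph V} {U : Set (OneComplex G)} :
    IsOpen U ↔ ∀ d : G.Dart, IsOpen (edgeMap G d ⁻¹' U) := by
  rw [isOpen_iSup_iff]
  simp only [isOpen_coinduced]

/-- The subspace `G[W]` of the 1-complex, i.e. the 1-complex of the subgraph of `G` induced by
the set `W` of vertices. -/
def inducedPart (G : SimpleGraph V) (W : Set V) : Set (OneComplex G) := {p | p.supp ⊆ W}

/-- The union of all closed edges at `v`. -/
def closedStar (G : SimpleGraph V) (v : V) : Set (OneComplex G) :=
  {p | ∃ w, G.Adj v w ∧ p.supp ⊆ {v, w}}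

/-- The neighbours of `v`, as points of the 1-complex. -/
def neighbourPoints (G : SimpleGraph V) (v : V) : Set (OneComplex G) :=
  vertexPoint G '' G.neighborSet v

/-! ## The Stone-Čech compactification and the two remainders -/

/-- The closure in the Stone-Čech compactification of a subset of the 1-complex. -/
def clBeta {G : SimpleGraph V} (A : Set (OneComplex G)) : Set (StoneCech (OneComplex G)) :=
  closure (stoneCechUnit '' A)

/-- The Stone-Čech remainder of (the 1-complex of) `G`. -/
def remainder (G : SimpleGraph V) : Set (StoneCech (OneComplex G)) :=
  (Set.range (stoneCechUnit : OneComplex G → StoneCech (OneComplex G)))ᶜ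

/-- The open set formed from the closure of the edges at `v` by removing the closure of the
neighbourhood of `v`. -/
def openStarBeta (G : SimpleGraph V) (v : V) : Set (StoneCech (OneComplex G)) :=
  clBeta (closedStar G v) \ clBeta (neighbourPoints G v)

/-- The auxiliary remainder of `G`. -/
def auxRemainder (G : SimpleGraph V) : Set (StoneCech (OneComplex G)) :=
  (⋃ v, openStarBeta G v)ᶜ

/-- `K` is a connected component of the subspace `S`. -/
def IsComponentOf {Y : Type*} [TopologicalSpace Y] (S K : Set Y) : Prop :=
  ∃ x ∈ S, K = connectedComponentIn S x

/-! ## Separations and tangles -/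

/-- `s = (A, B)` is an oriented finite-order separation of `G`. -/
structure IsSeparation (G : SimpleGraph V) (s : Set V × Set V) : Prop where
  finite_inter : (s.1 ∩ s.2).Finite
  union_eq : s.1 ∪ s.2 = Set.univ
  not_adj : ∀ a ∈ s.1 \ s.2, ∀ b ∈ s.2 \ s.1, ¬ G.Adj a b

/-- `(A, B) ≤ (C, D)` iff `A ⊆ C` and `B ⊇ D`. -/
def SepLE (r s : Set V × Set V) : Prop := r.1 ⊆ s.1 ∧ s.2 ⊆ r.2

/-- The strict version of `SepLE`. -/
def SepLT (r s : Set V × Set V) : Prop := SepLE r s ∧ r ≠ s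

/-- Any two distinct elements of `σ` point towards each other. -/
def IsStar (σ : Set (Set V × Set V)) : Prop :=
  ∀ r ∈ σ, ∀ s ∈ σ, r ≠ s → SepLE r s.swap

/-- An `ℵ₀`-tangle of `G`: a consistent orientation of the set of all finite-order separations
that contains no finite star of finite interior as a subset. -/
@[ext]
structure Tangle (G : SimpleGraph V) where
  carrier : Set (Set V × Set V)
  isSeparation : ∀ s ∈ carrier, IsSeparation G s
  orients : ∀ s, IsSeparation G s → Xor (s ∈ carrier) (s.swap ∈ carrier)
  consistent : ∀ r ∈ carrier, ∀ s ∈ carrier, r ≠ s → ¬ SepLT r.swap s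
  no_star : ∀ σ ⊆ carrier, σ.Finite → IsStar σ → ¬ (⋂ s ∈ σ, s.2).Finite

/-! ## Components after deleting finite vertex sets, and their finite partitions -/

/-- `V[𝒞]`: the union of the vertex sets of the components in `𝒞`. -/
def vertexUnion {G : SimpleGraph V} {X : Set V} (𝒞 : Set (G.ComponentCompl X)) : Set V :=
  ⋃ C ∈ 𝒞, (C : Set V)

/-- The oriented separation `(V \ V[𝒞], X ∪ V[𝒞])`. -/
def sepTo {G : SimpleGraph V} {X : Set V} (𝒞 : Set (G.ComponentCompl X)) : Set V × Set V :=
  ((vertexUnion 𝒞)ᶜ, X ∪ vertexUnion 𝒞)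

/-- `U(τ, X)`: the sets of components of `G - X` chosen as the big side by `τ`. -/
def Tangle.bigSides {G : SimpleGraph V} (τ : Tangle G) (X : Finset V) :
    Set (Set (G.ComponentCompl (X : Set V))) :=
  {𝒞 | sepTo 𝒞 ∈ τ.carrier}

/-- The set `Γ` of all pairs `(X, P)` of a finite vertex set `X` and a finite partition `P` (into
non-empty classes) of the set of components of `G - X`. -/
structure Gamma (G : SimpleGraph V) where
  X : Finset V
  P : Set (Set (G.ComponentCompl (X : Set V)))
  finite : P.Finite
  isPartition : Setoid.IsPartition P

/-- The subset `Γ'` of those `(X, P)` for which `V[𝒞]` is infinite for all classes `𝒞` of `P`. -/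
def Gamma.infinitary (G : SimpleGraph V) : Set (Gamma G) :=
  {γ | ∀ 𝒞 ∈ γ.P, (vertexUnion 𝒞).Infinite}

section Helpers

variable {G : SimpleGraph V} {X : Set V}

theorem disjoint_vertexUnion (𝒞 : Set (G.ComponentCompl X)) : Disjoint X (vertexUnion 𝒞) := by
  rw [Set.disjoint_left]
  intro v hv hv'
  simp only [vertexUnion, Set.mem_iUnion] at hv'
  obtain ⟨C, -, hC⟩ := hv'
  exact SimpleGraph.ComponentCompl.notMem_of_mem hC hv

theorem vertexUnion_disjoint {𝒞 𝒟 : Set (G.ComponentCompl X)} (h : Disjoint 𝒞 𝒟) :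
    Disjoint (vertexUnion 𝒞) (vertexUnion 𝒟) := by
  rw [Set.disjoint_left]
  intro v hv hv'
  simp only [vertexUnion, Set.mem_iUnion] at hv hv'
  obtain ⟨C, hC, hvC⟩ := hv
  obtain ⟨D, hD, hvD⟩ := hv'
  obtain ⟨_, rfl⟩ := hvC
  obtain ⟨_, rfl⟩ := hvD
  exact Set.disjoint_left.1 h hC hD

theorem vertexUnion_nonempty {𝒞 : Set (G.ComponentCompl X)} (h : 𝒞.Nonempty) :
    (vertexUnion 𝒞).Nonempty := by
  obtain ⟨C, hC⟩ := h
  obtain ⟨v, hv⟩ := C.nonempty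
  exact ⟨v, Set.mem_biUnion hC hv⟩

theorem isSeparation_sepTo (hX : X.Finite) (𝒞 : Set (G.ComponentCompl X)) :
    IsSeparation G (sepTo 𝒞) where
  finite_inter := hX.subset (by
    rintro v ⟨h1, h2 | h2⟩
    · exact h2
    · exact absurd h2 h1)
  union_eq := by
    ext v
    by_cases h : v ∈ vertexUnion 𝒞 <;> simp [sepTo, h]
  not_adj := by
    rintro a ⟨ha, ha'⟩ b ⟨-, hb'⟩ hab
    have hb : b ∈ vertexUnion 𝒞 := by simpa [sepTo] using hb'
    have haX : a ∉ X := fun h => ha' (Or.inl h)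
    simp only [vertexUnion, Set.mem_iUnion] at hb
    obtain ⟨C, hC, hbC⟩ := hb
    exact ha (Set.mem_biUnion hC
      (SimpleGraph.ComponentCompl.mem_of_adj b a hbC haX hab.symm))

end Helpers

/-- Exactly one class of `P` is chosen as a big side by `τ`. -/
theorem Tangle.existsUnique_class {G : SimpleGraph V} (τ : Tangle G) (γ : Gamma G) :
    ∃! 𝒞, 𝒞 ∈ γ.P ∧ 𝒞 ∈ τ.bigSides γ.X := by
  have hdisj : ∀ 𝒞 ∈ γ.P, ∀ 𝒟 ∈ γ.P, 𝒞 ≠ 𝒟 →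
      SepLE (sepTo 𝒞).swap (sepTo 𝒟) := by
    intro 𝒞 h𝒞 𝒟 h𝒟 hne
    have h1 := vertexUnion_disjoint (γ.isPartition.pairwiseDisjoint h𝒞 h𝒟 hne)
    have hC := disjoint_vertexUnion 𝒞
    have hD := disjoint_vertexUnion 𝒟
    constructor
    · rintro v (hv | hv)
      · exact fun h => Set.disjoint_left.1 hD hv h
      · exact fun h => Set.disjoint_left.1 h1 hv h
    · rintro v (hv | hv)
      · exact fun h => Set.disjoint_left.1 hC hv h
      · exact fun h => Set.disjoint_left.1 h1 h hv
  have hX : ((γ.X : Set V)).Finite := γ.X.finite_toSet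
  have hex : ∃ 𝒞, 𝒞 ∈ γ.P ∧ 𝒞 ∈ τ.bigSides γ.X := by
    by_contra hcon
    push Not at hcon
    have hsw : ∀ 𝒞 ∈ γ.P, (sepTo 𝒞).swap ∈ τ.carrier := by
      intro 𝒞 h𝒞
      rcases τ.orients _ (isSeparation_sepTo hX 𝒞) with h | h
      · exact absurd h.1 (hcon 𝒞 h𝒞)
      · exact h.1
    refine τ.no_star ((fun 𝒞 => (sepTo 𝒞).swap) '' γ.P) ?_ (γ.finite.image _) ?_ ?_
    · rintro _ ⟨𝒞, h𝒞, rfl⟩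
      exact hsw 𝒞 h𝒞
    · rintro _ ⟨𝒞, h𝒞, rfl⟩ _ ⟨𝒟, h𝒟, rfl⟩ hne
      simpa using hdisj 𝒞 h𝒞 𝒟 h𝒟 (fun h => hne (by rw [h]))
    · refine hX.subset fun v hv => ?_
      by_contra hvX
      obtain ⟨𝒞, ⟨h𝒞, hm⟩, -⟩ := γ.isPartition.2 (G.componentComplMk hvX)
      have h2 := Set.mem_iInter₂.1 hv _ (Set.mem_image_of_mem _ h𝒞)
      exact h2 (Set.mem_biUnion hm (SimpleGraph.componentComplMk_mem G hvX))
  obtain ⟨𝒞, h𝒞, h𝒞'⟩ := hex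
  refine ⟨𝒞, ⟨h𝒞, h𝒞'⟩, ?_⟩
  rintro 𝒟 ⟨h𝒟, h𝒟'⟩
  by_contra hne
  refine τ.consistent _ h𝒟' _ h𝒞' ?_ ⟨hdisj 𝒟 h𝒟 𝒞 h𝒞 hne, ?_⟩
  · intro h
    have hne' : 𝒟.Nonempty := Set.nonempty_iff_ne_empty.2
      fun h0 => γ.isPartition.1 (h0 ▸ h𝒟)
    obtain ⟨v, hv⟩ := vertexUnion_nonempty hne'
    have hv2 : v ∉ vertexUnion 𝒞 := Set.disjoint_left.1
      (vertexUnion_disjoint (γ.isPartition.pairwiseDisjoint h𝒟 h𝒞 hne)) hv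
    have h1 : v ∈ (sepTo 𝒞).1 := hv2
    rw [← h] at h1
    exact h1 hv
  · intro h
    rcases τ.orients _ (isSeparation_sepTo hX 𝒟) with h' | h'
    · exact h'.2 (h ▸ h𝒞')
    · exact h'.2 h𝒟'

/-- `𝒞(τ, γ)`: the unique class of the partition `P` that lies in `U(τ, X)`, where `γ = (X, P)`. -/
noncomputable def Tangle.bigClass {G : SimpleGraph V} (τ : Tangle G) (γ : Gamma G) :
    Set (G.ComponentCompl (γ.X : Set V)) :=
  Classical.choose (τ.existsUnique_class γ).exists

theorem Tangle.bigClass_spec {G : SimpleGraph V} (τ : Tangle G) (γ : Gamma G) :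
    τ.bigClass γ ∈ γ.P ∧ τ.bigClass γ ∈ τ.bigSides γ.X :=
  Classical.choose_spec (τ.existsUnique_class γ).exists

/-- The union of the components in `𝒞`, as a subspace of the 1-complex. -/
def componentUnion {G : SimpleGraph V} {X : Set V} (𝒞 : Set (G.ComponentCompl X)) :
    Set (OneComplex G) :=
  ⋃ C ∈ 𝒞, inducedPart G (C : Set V)

/-- `G[τ, γ]`: the subgraph of `G` induced by `X ∪ V[𝒞(τ, γ)]`, where `γ = (X, P)`. -/
def Tangle.bigPart {G : SimpleGraph V} (τ : Tangle G) (γ : Gamma G) : Set (OneComplex G) :=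
  inducedPart G ((γ.X : Set V) ∪ vertexUnion (τ.bigClass γ))

/-! ## The components corresponding to a tangle -/

/-- The component `K` of the auxiliary remainder corresponds to the tangle `τ`: for every
`γ = (X, P)` and every point `x` of `K`, the unique class of `P` whose closure contains `x` is
`𝒞(τ, γ)`. -/
def Tangle.AuxCorresponds {G : SimpleGraph V} (τ : Tangle G)
    (K : Set (StoneCech (OneComplex G))) : Prop :=
  IsComponentOf (auxRemainder G) K ∧
    ∀ x ∈ K, ∀ γ : Gamma G, ∀ 𝒞 ∈ γ.P, x ∈ clBeta (componentUnion 𝒞) ↔ 𝒞 = τ.bigClass γ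

/-- The component `L` of the Stone-Čech remainder corresponds to the tangle `τ`: it includes the
component of the auxiliary remainder that corresponds to `τ`. -/
def Tangle.Corresponds {G : SimpleGraph V} (τ : Tangle G)
    (L : Set (StoneCech (OneComplex G))) : Prop :=
  IsComponentOf (remainder G) L ∧ ∃ K, τ.AuxCorresponds K ∧ K ⊆ L

end StoneTangle

namespace StoneTangle

variable {V : Type u} {G : SimpleGraph V}

/-! ## Points of the 1-complex -/

/-! To a tangle `τ` belongs its core: the intersection of the closures of `G[B \ A]` over all `(A,
B)` in `τ`. The theorem holds because the cores are exactly the components of the auxiliary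
remainder, and because every component of the Stone-Čech remainder contains exactly one of them.

The 1-complex is normal, so closure in the compactification commutes with intersections of closed
sets (`clBeta_inter`). A tangle is closed under suprema (`Tangle.sup_mem`), so the sets defining its
core are directed, and compactness makes the core non-empty. The core is connected, since a tangle
has to choose between the two parts of any splitting of `G[B \ A]` by disjoint open sets
(`Tangle.isPreconnected_core`).

Conversely, a point of the auxiliary remainder lies in the closure of exactly one strict side of
each separation (`mem_clBeta_side_or`), and these sides form a tangle (`tangleOf`). So the cores
partition the auxiliary remainder. As the closures of the two strict sides are disjoint and closed,
a connected set cannot meet two cores.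

In the Stone-Čech remainder only the closures of `G[A]` and `G[B]` are at hand; they overlap in a
compact part of the 1-complex, which the remainder misses. This bounds a component from above by an
outer core. Equality holds because every further point, which lies in the closure of the star of
some vertex, is joined to the auxiliary remainder by a connected set, built from an ultrafilter on
the edges of that star (`exists_isPreconnected_of_mem_closedStar`).

The formulas follow since strict big sides of separations in `τ` are the sets `V[𝒞(τ, γ)]`, and `γ`
in `Γ'` suffices (`Tangle.exists_bigClass_eq_side`). -/

theorem edgeMap_apply (d : G.Dart) (t : unitInterval) (u : V) [DecidableEq V] :
    (edgeMap G d t).1 u =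
      (if d.fst = u then 1 - (t : ℝ) else 0) + (if d.snd = u then (t : ℝ) else 0) := by
  simp only [edgeMap, edgeCoord, Finsupp.add_apply, Finsupp.single_apply]

theorem edgeMap_apply_fst (d : G.Dart) (t : unitInterval) :
    (edgeMap G d t).1 d.fst = 1 - (t : ℝ) := by
  classical
  rw [edgeMap_apply, if_pos rfl, if_neg d.adj.ne', add_zero]

theorem edgeMap_apply_snd (d : G.Dart) (t : unitInterval) :
    (edgeMap G d t).1 d.snd = (t : ℝ) := by
  classical
  rw [edgeMap_apply, if_pos rfl, if_neg d.adj.ne, zero_add]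

theorem edgeMap_zero (d : G.Dart) : edgeMap G d 0 = vertexPoint G d.fst :=
  Subtype.ext (by simp [edgeMap, edgeCoord, vertexPoint])

theorem edgeMap_one (d : G.Dart) : edgeMap G d 1 = vertexPoint G d.snd :=
  Subtype.ext (by simp [edgeMap, edgeCoord, vertexPoint])

theorem edgeMap_symm (d : G.Dart) (t : unitInterval) :
    edgeMap G d.symm t = edgeMap G d (unitInterval.symm t) :=
  Subtype.ext (by simp [edgeMap, edgeCoord, add_comm])

theorem edgeMap_injective (d : G.Dart) : Function.Injective (edgeMap G d) := by
  intro s t h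
  have := congrArg (fun p : OneComplex G => p.1 d.snd) h
  simp only [edgeMap_apply_snd] at this
  exact Subtype.ext this

theorem supp_edgeMap_subset (d : G.Dart) (t : unitInterval) :
    (edgeMap G d t).supp ⊆ {d.fst, d.snd} := by
  classical
  intro u hu
  by_contra hcon
  simp only [Set.mem_insert_iff, Set.mem_singleton_iff, not_or] at hcon
  exact hu (by rw [edgeMap_apply, if_neg (Ne.symm hcon.1), if_neg (Ne.symm hcon.2), add_zero])

theorem fst_mem_supp_edgeMap {d : G.Dart} {t : unitInterval} :
    d.fst ∈ (edgeMap G d t).supp ↔ t ≠ 1 := by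
  change (edgeMap G d t).1 d.fst ≠ 0 ↔ _
  rw [edgeMap_apply_fst, sub_ne_zero, not_iff_not, eq_comm, ← Subtype.coe_inj]
  rfl

theorem snd_mem_supp_edgeMap {d : G.Dart} {t : unitInterval} :
    d.snd ∈ (edgeMap G d t).supp ↔ t ≠ 0 := by
  change (edgeMap G d t).1 d.snd ≠ 0 ↔ _
  rw [edgeMap_apply_snd, not_iff_not, ← Subtype.coe_inj]
  rfl

theorem supp_vertexPoint (v : V) : (vertexPoint G v).supp = {v} := by
  classical
  ext u
  simp [OneComplex.supp, vertexPoint, Finsupp.single_apply, eq_comm]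

theorem vertexPoint_injective : Function.Injective (vertexPoint G) := by
  intro v w h
  have := supp_vertexPoint (G := G) v
  rw [h, supp_vertexPoint] at this
  exact (Set.singleton_injective this).symm

theorem supp_nonempty (p : OneComplex G) : p.supp.Nonempty := by
  obtain ⟨f, ⟨v, rfl⟩ | ⟨v, w, h, t, ht, rfl⟩⟩ := p
  · exact ⟨v, (supp_vertexPoint (G := G) v).ge rfl⟩
  · by_cases h0 : t = 0
    · exact ⟨v, fst_mem_supp_edgeMap (d := ⟨(v, w), h⟩) (t := ⟨t, ht⟩).2
        (fun h1 => by simp [h0] at h1)⟩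
    · exact ⟨w, snd_mem_supp_edgeMap (d := ⟨(v, w), h⟩) (t := ⟨t, ht⟩).2
        (fun h1 => h0 (congrArg Subtype.val h1))⟩

theorem exists_eq_edgeMap (hG : ∀ v, ∃ w, G.Adj v w) (p : OneComplex G) :
    ∃ d t, p = edgeMap G d t := by
  obtain ⟨f, ⟨v, rfl⟩ | ⟨v, w, h, t, ht, rfl⟩⟩ := p
  · obtain ⟨w, h⟩ := hG v
    exact ⟨⟨(v, w), h⟩, 0, (edgeMap_zero ⟨(v, w), h⟩).symm⟩
  · exact ⟨⟨(v, w), h⟩, ⟨t, ht⟩, rfl⟩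

theorem eq_vertexPoint_of_supp_subset {p : OneComplex G} {v : V} (h : p.supp ⊆ {v}) :
    p = vertexPoint G v := by
  obtain ⟨f, ⟨w, rfl⟩ | ⟨a, b, hab, t, ht, rfl⟩⟩ := p
  · have h1 : w ∈ ({v} : Set V) := h ((supp_vertexPoint (G := G) w).ge rfl)
    obtain rfl : w = v := h1
    rfl
  · set d : G.Dart := ⟨(a, b), hab⟩
    change edgeMap G d ⟨t, ht⟩ = _
    change (edgeMap G d ⟨t, ht⟩).supp ⊆ _ at h
    by_cases h0 : (⟨t, ht⟩ : unitInterval) = 0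
    · rw [h0, edgeMap_zero] at h ⊢
      rw [supp_vertexPoint, Set.singleton_subset_singleton] at h
      rw [h]
    by_cases h1 : (⟨t, ht⟩ : unitInterval) = 1
    · rw [h1, edgeMap_one] at h ⊢
      rw [supp_vertexPoint, Set.singleton_subset_singleton] at h
      rw [h]
    · have ha : a = v := h (fst_mem_supp_edgeMap (d := d).2 h1)
      have hb : b = v := h (snd_mem_supp_edgeMap (d := d).2 h0)
      exact absurd (ha.trans hb.symm) hab.ne

theorem continuous_edgeMap (d : G.Dart) : Continuous (edgeMap G d) :=
  continuous_def.2 fun _ hU => isOpen_iff.1 hU d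

theorem isClosed_iff {A : Set (OneComplex G)} :
    IsClosed A ↔ ∀ d : G.Dart, IsClosed (edgeMap G d ⁻¹' A) := by
  simp only [← isOpen_compl_iff, isOpen_iff, Set.preimage_compl]

/-- The support of an inner point consists of both ends of its edge, so it determines the edge up to
direction. -/
theorem edgeMap_eq_edgeMap {d e : G.Dart} {s t : unitInterval}
    (h : edgeMap G d s = edgeMap G e t) :
    (d = e ∧ s = t) ∨ (d = e.symm ∧ s = unitInterval.symm t) ∨
      ∃ v, edgeMap G d s = vertexPoint G v := by
  by_cases hs0 : s = 0
  · exact .inr (.inr ⟨_, hs0 ▸ edgeMap_zero d⟩)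
  by_cases hs1 : s = 1
  · exact .inr (.inr ⟨_, hs1 ▸ edgeMap_one d⟩)
  have h1 := fst_mem_supp_edgeMap (d := d).2 hs1
  have h2 := snd_mem_supp_edgeMap (d := d).2 hs0
  rw [h] at h1 h2
  have hne := d.adj.ne
  rcases supp_edgeMap_subset e t h1 with h1 | h1 <;>
    rcases supp_edgeMap_subset e t h2 with h2 | h2
  · exact absurd (h1.trans h2.symm) hne
  · obtain rfl : d = e := SimpleGraph.Dart.ext _ _ (Prod.ext h1 h2)
    exact .inl ⟨rfl, edgeMap_injective d h⟩
  · obtain rfl : d = e.symm := SimpleGraph.Dart.ext _ _ (Prod.ext h1 h2)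
    refine .inr (.inl ⟨rfl, ?_⟩)
    rw [edgeMap_symm] at h
    rw [← edgeMap_injective e h, unitInterval.symm_symm]
  · exact absurd (h1.trans h2.symm) hne

theorem edgeMap_eq_vertexPoint {d : G.Dart} {s : unitInterval} {v : V}
    (h : edgeMap G d s = vertexPoint G v) : (d.fst = v ∧ s = 0) ∨ (d.snd = v ∧ s = 1) := by
  have hsupp := supp_vertexPoint (G := G) v
  rw [← h] at hsupp
  by_cases hs0 : s = 0
  · subst hs0
    rw [edgeMap_zero] at h
    exact .inl ⟨vertexPoint_injective h, rfl⟩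
  by_cases hs1 : s = 1
  · subst hs1
    rw [edgeMap_one] at h
    exact .inr ⟨vertexPoint_injective h, rfl⟩
  have h1 : d.fst = v := hsupp.le (fst_mem_supp_edgeMap (d := d).2 hs1)
  have h2 : d.snd = v := hsupp.le (snd_mem_supp_edgeMap (d := d).2 hs0)
  exact absurd (h1.trans h2.symm) d.adj.ne

/-- Compatible continuous functions on the closed edges glue to a continuous function. -/
theorem exists_glue {Z : Type*} [TopologicalSpace Z] (hG : ∀ v, ∃ w, G.Adj v w) (φ : V → Z)
    (F : G.Dart → unitInterval → Z) (hF : ∀ d, Continuous (F d))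
    (hsymm : ∀ d t, F d.symm t = F d (unitInterval.symm t)) (h0 : ∀ d, F d 0 = φ d.fst) :
    ∃ f : OneComplex G → Z, Continuous f ∧ ∀ d t, f (edgeMap G d t) = F d t := by
  have h1 : ∀ d, F d 1 = φ d.snd := fun d => by
    have := hsymm d 0
    rw [unitInterval.symm_zero, h0] at this
    exact this.symm
  have hv : ∀ d s v, edgeMap G d s = vertexPoint G v → F d s = φ v := by
    intro d s v h
    rcases edgeMap_eq_vertexPoint h with ⟨rfl, rfl⟩ | ⟨rfl, rfl⟩
    exacts [h0 d, h1 d]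
  have hwd : ∀ d s e t, edgeMap G d s = edgeMap G e t → F d s = F e t := by
    intro d s e t h
    rcases edgeMap_eq_edgeMap h with ⟨rfl, rfl⟩ | ⟨rfl, rfl⟩ | ⟨v, h'⟩
    · rfl
    · rw [hsymm, unitInterval.symm_symm]
    · rw [hv d s v h', hv e t v (h ▸ h')]
  choose d t hdt using exists_eq_edgeMap hG
  have key : ∀ e s, F (d (edgeMap G e s)) (t (edgeMap G e s)) = F e s :=
    fun e s => hwd _ _ _ _ (hdt _).symm
  refine ⟨fun p => F (d p) (t p), ?_, key⟩
  refine continuous_def.2 fun U hU => isOpen_iff.2 fun e => ?_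
  have : edgeMap G e ⁻¹' ((fun p => F (d p) (t p)) ⁻¹' U) = F e ⁻¹' U := by
    ext s
    simp only [Set.mem_preimage, key]
  rw [this]
  exact hU.preimage (hF e)

/-- Urysohn functions are taken on each edge separately, with values at the ends prescribed in
advance so that they glue. -/
theorem exists_urysohn (hG : ∀ v, ∃ w, G.Adj v w) {A B : Set (OneComplex G)} (hA : IsClosed A)
    (hB : IsClosed B) (hAB : Disjoint A B) :
    ∃ f : OneComplex G → unitInterval, Continuous f ∧ (∀ p ∈ A, f p = 0) ∧ ∀ p ∈ B, f p = 1 := by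
  classical
  set φ : V → ℝ := fun v => if vertexPoint G v ∈ B then 1 else 0 with hφ
  have hloc : ∀ d : G.Dart, ∃ g : C(unitInterval, ℝ), (∀ t, g t ∈ Set.Icc (0 : ℝ) 1) ∧
      (∀ t, edgeMap G d t ∈ A → g t = 0) ∧ (∀ t, edgeMap G d t ∈ B → g t = 1) ∧
      g 0 = φ d.fst ∧ g 1 = φ d.snd := by
    intro d
    -- Ends outside `B` join the zero set, which forces the value `φ` at both ends.
    set E : Set unitInterval := {t | (t = 0 ∨ t = 1) ∧ edgeMap G d t ∉ B}
    have hE : IsClosed E :=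
      ((Set.toFinite {0, 1}).subset fun t ht => by simpa using ht.1).isClosed
    have hA' : IsClosed (edgeMap G d ⁻¹' A ∪ E) := (isClosed_iff.1 hA d).union hE
    have hdis : Disjoint (edgeMap G d ⁻¹' A ∪ E) (edgeMap G d ⁻¹' B) := by
      rw [Set.disjoint_left]
      rintro t (ht | ht) htB
      · exact Set.disjoint_left.1 hAB ht htB
      · exact ht.2 htB
    obtain ⟨g, g0, g1, g2⟩ := exists_continuous_zero_one_of_isClosed hA' (isClosed_iff.1 hB d) hdis
    have hend : ∀ t v, (t = 0 ∨ t = 1) → edgeMap G d t = vertexPoint G v → g t = φ v := by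
      intro t v ht hv
      by_cases hb : vertexPoint G v ∈ B
      · simp only [hφ, if_pos hb]
        exact g1 (show edgeMap G d t ∈ B from hv ▸ hb)
      · simp only [hφ, if_neg hb]
        exact g0 (.inr ⟨ht, hv ▸ hb⟩)
    exact ⟨g, g2, fun t ht => g0 (.inl ht), fun t ht => g1 ht,
      hend _ _ (.inl rfl) (edgeMap_zero d), hend _ _ (.inr rfl) (edgeMap_one d)⟩
  choose g hg gA gB g0 g1 using hloc
  obtain ⟨f, hf, hfe⟩ := exists_glue hG φ
    -- Averaging over the two directions of an edge gives the symmetry that gluing needs.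
    (fun d t => (g d t + g d.symm (unitInterval.symm t)) / 2)
    (fun d => by fun_prop) (fun d t => by simp [add_comm])
    (fun d => by simp [g0, g1])
  have hfI : ∀ p, f p ∈ Set.Icc (0 : ℝ) 1 := by
    intro p
    obtain ⟨d, t, rfl⟩ := exists_eq_edgeMap hG p
    rw [hfe]
    have h1 := hg d t
    have h2 := hg d.symm (unitInterval.symm t)
    constructor <;> linarith [h1.1, h1.2, h2.1, h2.2]
  have hsym : ∀ (d : G.Dart) t, edgeMap G d.symm (unitInterval.symm t) = edgeMap G d t :=
    fun d t => by rw [edgeMap_symm, unitInterval.symm_symm]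
  refine ⟨fun p => ⟨f p, hfI p⟩, by fun_prop, fun p hp => Subtype.ext ?_,
    fun p hp => Subtype.ext ?_⟩
  · obtain ⟨d, t, rfl⟩ := exists_eq_edgeMap hG p
    simp [hfe, gA d t hp, gA d.symm (unitInterval.symm t) ((hsym d t).symm ▸ hp)]
  · obtain ⟨d, t, rfl⟩ := exists_eq_edgeMap hG p
    simp [hfe, gB d t hp, gB d.symm (unitInterval.symm t) ((hsym d t).symm ▸ hp)]

theorem isClosed_of_finite_trace {A : Set (OneComplex G)}
    (h : ∀ d : G.Dart, (edgeMap G d ⁻¹' A).Finite) : IsClosed A :=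
  isClosed_iff.2 fun d => (h d).isClosed

theorem t4Space (hG : ∀ v, ∃ w, G.Adj v w) : T4Space (OneComplex G) := by
  have h1 : T1Space (OneComplex G) := ⟨fun p => isClosed_of_finite_trace fun d =>
    (Set.finite_singleton p).preimage (edgeMap_injective d).injOn⟩
  have h2 : NormalSpace (OneComplex G) := by
    refine ⟨fun A B hA hB hAB => ?_⟩
    obtain ⟨f, hf, f0, f1⟩ := exists_urysohn hG hA hB hAB
    obtain ⟨U, W, hU, hW, hU0, hW1, hUW⟩ := t2_separation (zero_ne_one (α := unitInterval))
    exact ⟨f ⁻¹' U, f ⁻¹' W, hU.preimage hf, hW.preimage hf,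
      fun p hp => by simpa [f0 p hp] using hU0, fun p hp => by simpa [f1 p hp] using hW1,
      hUW.preimage f⟩
  exact { }

/-! ### Closed and compact subspaces of the 1-complex -/

theorem isClosed_inducedPart (W : Set V) : IsClosed (inducedPart G W) := by
  refine isClosed_iff.2 fun d => ?_
  have : edgeMap G d ⁻¹' inducedPart G W =
      {t | t = 1 ∨ d.fst ∈ W} ∩ {t | t = 0 ∨ d.snd ∈ W} := by
    ext t
    constructor
    · intro h
      exact ⟨or_iff_not_imp_left.2 fun h1 => h (fst_mem_supp_edgeMap.2 h1),
        or_iff_not_imp_left.2 fun h1 => h (snd_mem_supp_edgeMap.2 h1)⟩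
    · rintro ⟨h1, h2⟩ u hu
      rcases supp_edgeMap_subset d t hu with rfl | rfl
      · exact h1.resolve_left (fst_mem_supp_edgeMap.1 hu)
      · exact h2.resolve_left (snd_mem_supp_edgeMap.1 hu)
  rw [this]
  exact (isClosed_singleton.union isClosed_const).inter (isClosed_singleton.union isClosed_const)

theorem trace_subset_of_notMem {v : V} {d : G.Dart} (h1 : d.fst ≠ v) (h2 : d.snd ≠ v)
    {t : unitInterval} {w : V} (h : (edgeMap G d t).supp ⊆ {v, w}) :
    t ∈ ({0, 1} : Set unitInterval) := by
  by_contra hcon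
  simp only [Set.mem_insert_iff, Set.mem_singleton_iff, not_or] at hcon
  have h3 := (h (fst_mem_supp_edgeMap.2 hcon.2)).resolve_left h1
  have h4 := (h (snd_mem_supp_edgeMap.2 hcon.1)).resolve_left h2
  exact d.adj.ne (h3.trans h4.symm)

theorem isClosed_closedStar (v : V) : IsClosed (closedStar G v) := by
  refine isClosed_iff.2 fun d => ?_
  by_cases h1 : d.fst = v
  · convert isClosed_univ
    exact Set.eq_univ_of_forall fun t => ⟨d.snd, h1 ▸ d.adj, h1 ▸ supp_edgeMap_subset d t⟩
  by_cases h2 : d.snd = v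
  · convert isClosed_univ
    refine Set.eq_univ_of_forall fun t => ⟨d.fst, h2 ▸ d.adj.symm, ?_⟩
    rw [Set.pair_comm]
    exact h2 ▸ supp_edgeMap_subset d t
  · refine ((Set.toFinite {0, 1}).subset ?_).isClosed
    rintro t ⟨w, -, h⟩
    exact trace_subset_of_notMem h1 h2 h

theorem isClosed_image_vertexPoint (S : Set V) : IsClosed (vertexPoint G '' S) := by
  refine isClosed_of_finite_trace fun d => (Set.toFinite {0, 1}).subset ?_
  rintro t ⟨v, -, h⟩
  rcases edgeMap_eq_vertexPoint h.symm with h | h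
  exacts [.inl h.2, .inr h.2]

theorem mem_closedStar (hG : ∀ v, ∃ w, G.Adj v w) {p : OneComplex G} {v : V} (hv : v ∈ p.supp) :
    p ∈ closedStar G v := by
  obtain ⟨d, t, rfl⟩ := exists_eq_edgeMap hG p
  rcases supp_edgeMap_subset d t hv with rfl | rfl
  · exact ⟨d.snd, d.adj, supp_edgeMap_subset d t⟩
  · exact ⟨d.fst, d.adj.symm, Set.pair_comm d.fst d.snd ▸ supp_edgeMap_subset d t⟩

/-- Only finitely many edges have both ends in `X`. Vertices are added to the cover because one may
be isolated in `G[X]`. -/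
theorem isCompact_inducedPart (hG : ∀ v, ∃ w, G.Adj v w) {X : Set V} (hX : X.Finite) :
    IsCompact (inducedPart G X) := by
  have hfin : {d : G.Dart | d.fst ∈ X ∧ d.snd ∈ X}.Finite :=
    (hX.prod hX).preimage (f := SimpleGraph.Dart.toProd)
      (fun _ _ _ _ h => SimpleGraph.Dart.ext _ _ h) |>.subset fun d hd => hd
  have hc : IsCompact ((⋃ d ∈ {d : G.Dart | d.fst ∈ X ∧ d.snd ∈ X}, Set.range (edgeMap G d)) ∪
      vertexPoint G '' X) :=
    (hfin.isCompact_biUnion fun d _ => isCompact_range (continuous_edgeMap d)).union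
      (hX.image _).isCompact
  refine hc.of_isClosed_subset (isClosed_inducedPart X) fun p hp => ?_
  obtain ⟨d, t, rfl⟩ := exists_eq_edgeMap hG p
  by_cases h0 : t = 0
  · subst h0
    exact .inr ⟨d.fst, hp (fst_mem_supp_edgeMap.2 zero_ne_one), (edgeMap_zero d).symm⟩
  by_cases h1 : t = 1
  · subst h1
    exact .inr ⟨d.snd, hp (snd_mem_supp_edgeMap.2 one_ne_zero), (edgeMap_one d).symm⟩
  · exact .inl (Set.mem_biUnion (x := d)
      ⟨hp (fst_mem_supp_edgeMap.2 h1), hp (snd_mem_supp_edgeMap.2 h0)⟩ ⟨t, rfl⟩)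

theorem inducedPart_mono {W W' : Set V} (h : W ⊆ W') : inducedPart G W ⊆ inducedPart G W' :=
  fun _ hp => hp.trans h

theorem inducedPart_inter (W W' : Set V) :
    inducedPart G (W ∩ W') = inducedPart G W ∩ inducedPart G W' :=
  Set.ext fun _ => Set.subset_inter_iff

theorem disjoint_inducedPart {W W' : Set V} (h : Disjoint W W') :
    Disjoint (inducedPart G W) (inducedPart G W') := by
  rw [Set.disjoint_left]
  intro p hp hp'
  obtain ⟨v, hv⟩ := supp_nonempty p
  exact Set.disjoint_left.1 h (hp hv) (hp' hv)

/-- No edge crosses a separation, so each closed edge lies in one of the two sides. -/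
theorem inducedPart_union_of_isSeparation (hG : ∀ v, ∃ w, G.Adj v w) {s : Set V × Set V}
    (hs : IsSeparation G s) : inducedPart G s.1 ∪ inducedPart G s.2 = Set.univ := by
  refine Set.eq_univ_of_forall fun p => ?_
  obtain ⟨d, t, rfl⟩ := exists_eq_edgeMap hG p
  have key : ({d.fst, d.snd} : Set V) ⊆ s.1 ∨ ({d.fst, d.snd} : Set V) ⊆ s.2 := by
    have hu : ∀ v, v ∈ s.1 ∨ v ∈ s.2 := fun v => hs.union_eq.ge (Set.mem_univ v)
    have h1 := hs.not_adj d.fst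
    have h2 := hs.not_adj d.snd
    have h3 := d.adj
    have h4 := d.adj.symm
    have := hu d.fst
    have := hu d.snd
    simp only [Set.insert_subset_iff, Set.singleton_subset_iff]
    by_contra hcon
    simp only [Set.mem_sdiff] at h1 h2
    grind
  exact key.imp (supp_edgeMap_subset d t).trans (supp_edgeMap_subset d t).trans

theorem componentUnion_eq_inducedPart (hG : ∀ v, ∃ w, G.Adj v w) {X : Set V}
    (𝒞 : Set (G.ComponentCompl X)) : componentUnion 𝒞 = inducedPart G (vertexUnion 𝒞) := by
  apply Set.Subset.antisymm
  · exact Set.iUnion₂_subset fun C hC => inducedPart_mono (Set.subset_biUnion_of_mem hC)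
  · intro p hp
    obtain ⟨d, t, rfl⟩ := exists_eq_edgeMap hG p
    obtain ⟨u, hu⟩ := supp_nonempty (edgeMap G d t)
    obtain ⟨C, hC, huC⟩ := Set.mem_iUnion₂.1 (hp hu)
    refine Set.mem_biUnion hC fun w hw => ?_
    have hwX : w ∉ X := fun h => Set.disjoint_left.1 (disjoint_vertexUnion 𝒞) h (hp hw)
    have h1 := supp_edgeMap_subset d t hu
    have h2 := supp_edgeMap_subset d t hw
    by_cases huw : u = w
    · exact huw ▸ huC
    refine SimpleGraph.ComponentCompl.mem_of_adj u w huC hwX ?_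
    rcases h1 with rfl | rfl <;> rcases h2 with rfl | rfl
    exacts [absurd rfl huw, d.adj, d.adj.symm, absurd rfl huw]

/-! ## Closures in the Stone-Čech compactification -/

theorem isClosed_clBeta (A : Set (OneComplex G)) : IsClosed (clBeta A) := isClosed_closure

theorem clBeta_mono {A B : Set (OneComplex G)} (h : A ⊆ B) : clBeta A ⊆ clBeta B :=
  closure_mono (Set.image_mono h)

theorem clBeta_union (A B : Set (OneComplex G)) : clBeta (A ∪ B) = clBeta A ∪ clBeta B := by
  simp only [clBeta, Set.image_union, closure_union]

theorem clBeta_univ : clBeta (Set.univ : Set (OneComplex G)) = Set.univ := by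
  rw [clBeta, Set.image_univ]
  exact denseRange_stoneCechUnit.closure_range

theorem mem_clBeta_unit (hG : ∀ v, ∃ w, G.Adj v w) {A : Set (OneComplex G)} (hA : IsClosed A)
    {p : OneComplex G} : stoneCechUnit p ∈ clBeta A ↔ p ∈ A := by
  have := t4Space hG
  have h := isEmbedding_stoneCechUnit (X := OneComplex G) |>.isInducing
    |>.closure_eq_preimage_closure_image A
  rw [hA.closure_eq] at h
  exact (Set.ext_iff.1 h p).symm

theorem clBeta_of_isCompact {A : Set (OneComplex G)} (hA : IsCompact A) :
    clBeta A = stoneCechUnit '' A :=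
  (hA.image continuous_stoneCechUnit).isClosed.closure_eq

/-- The extension of a Urysohn function takes the value 0 on one closure and 1 on the other. -/
theorem disjoint_clBeta (hG : ∀ v, ∃ w, G.Adj v w) {A B : Set (OneComplex G)} (hA : IsClosed A)
    (hB : IsClosed B) (hAB : Disjoint A B) : Disjoint (clBeta A) (clBeta B) := by
  obtain ⟨f, hf, f0, f1⟩ := exists_urysohn hG hA hB hAB
  have hA' : clBeta A ⊆ stoneCechExtend hf ⁻¹' {0} :=
    closure_minimal (by rintro _ ⟨p, hp, rfl⟩; simp [f0 p hp])
      (isClosed_singleton.preimage (continuous_stoneCechExtend hf))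
  have hB' : clBeta B ⊆ stoneCechExtend hf ⁻¹' {1} :=
    closure_minimal (by rintro _ ⟨p, hp, rfl⟩; simp [f1 p hp])
      (isClosed_singleton.preimage (continuous_stoneCechExtend hf))
  exact ((Set.disjoint_singleton.2 zero_ne_one).preimage _).mono hA' hB'

/-- A point of both closures outside the closure of `A ∩ B` has a closed neighbourhood `N` missing
the latter. Inside `N` the sets `A` and `B` are disjoint, yet the point remains in both closures. -/
theorem clBeta_inter (hG : ∀ v, ∃ w, G.Adj v w) {A B : Set (OneComplex G)} (hA : IsClosed A)
    (hB : IsClosed B) : clBeta (A ∩ B) = clBeta A ∩ clBeta B := by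
  refine (Set.subset_inter (clBeta_mono Set.inter_subset_left)
    (clBeta_mono Set.inter_subset_right)).antisymm ?_
  rintro x ⟨hxA, hxB⟩
  by_contra hx
  obtain ⟨N, hN, hNc, hNsub⟩ :=
    exists_mem_nhds_isClosed_subset ((isClosed_clBeta (A ∩ B)).isOpen_compl.mem_nhds hx)
  have hres : ∀ A : Set (OneComplex G), x ∈ clBeta A → x ∈ clBeta (A ∩ stoneCechUnit ⁻¹' N) := by
    intro A hxA
    refine mem_closure_iff_nhds.2 fun U hU => ?_
    obtain ⟨_, ⟨h1, h2⟩, p, hp, rfl⟩ := mem_closure_iff_nhds.1 hxA _ (Filter.inter_mem hU hN)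
    exact ⟨_, h1, p, ⟨hp, h2⟩, rfl⟩
  have hNc' : IsClosed (stoneCechUnit ⁻¹' N : Set (OneComplex G)) :=
    hNc.preimage continuous_stoneCechUnit
  refine Set.disjoint_left.1 (disjoint_clBeta hG (hA.inter hNc') (hB.inter hNc') ?_)
    (hres A hxA) (hres B hxB)
  rw [Set.disjoint_left]
  rintro p ⟨hpA, hpN⟩ ⟨hpB, -⟩
  exact hNsub hpN (subset_closure ⟨p, ⟨hpA, hpB⟩, rfl⟩)

/-- A directed intersection of closures is connected, if each set of the family can be refined to
one side of any separation by disjoint open sets. -/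
theorem isPreconnected_iInter_closure {Y ι : Type*} [TopologicalSpace Y] [CompactSpace Y]
    [T2Space Y] [Nonempty ι] (F : ι → Set Y) (hdir : Directed (· ⊇ ·) F)
    (hsplit : ∀ i O₁ O₂, IsOpen O₁ → IsOpen O₂ → Disjoint O₁ O₂ → F i ⊆ O₁ ∪ O₂ →
      ∃ j, F j ⊆ O₁ ∨ F j ⊆ O₂) :
    IsPreconnected (⋂ i, closure (F i)) := by
  rw [isPreconnected_iff_subset_of_fully_disjoint_closed (isClosed_iInter fun _ => isClosed_closure)]
  intro u v hu hv huv hdisj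
  obtain ⟨O₁, O₂, h1, h2, hu1, hv2, hO⟩ := normal_separation hu hv hdisj
  have hdir' : Directed (· ⊇ ·) fun i => closure (F i) :=
    fun i j =>
    (hdir i j).imp fun _ h => ⟨closure_mono h.1, closure_mono h.2⟩
  -- By compactness a single member of the family already lies in `O₁ ∪ O₂`.
  obtain ⟨i, hi⟩ := exists_subset_nhds_of_isCompact hdir' (fun i => isClosed_closure.isCompact)
    (U := O₁ ∪ O₂) fun x hx =>
      (h1.union h2).mem_nhds (Set.union_subset_union hu1 hv2 (huv hx))
  obtain ⟨j, hj | hj⟩ := hsplit i O₁ O₂ h1 h2 hO (subset_closure.trans hi)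
  · left
    intro x hx
    refine (huv hx).resolve_right fun hxv => ?_
    exact Set.disjoint_left.1 (hO.closure_left h2)
      (closure_mono hj (Set.mem_iInter.1 hx j)) (hv2 hxv)
  · right
    intro x hx
    refine (huv hx).resolve_left fun hxu => ?_
    exact Set.disjoint_left.1 (hO.symm.closure_left h1)
      (closure_mono hj (Set.mem_iInter.1 hx j)) (hu1 hxu)

/-! ## Separations and tangles -/

/-- The strict big side `B \ A` of a separation `(A, B)`. -/
def side (s : Set V × Set V) : Set V := s.2 \ s.1

theorem IsSeparation.mem_or {s : Set V × Set V} (hs : IsSeparation G s) (v : V) :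
    v ∈ s.1 ∨ v ∈ s.2 := hs.union_eq.ge (Set.mem_univ v)

theorem IsSeparation.swap {s : Set V × Set V} (hs : IsSeparation G s) : IsSeparation G s.swap where
  finite_inter := by simpa [Set.inter_comm] using hs.finite_inter
  union_eq := by simpa [Set.union_comm] using hs.union_eq
  not_adj a ha b hb h := hs.not_adj b hb a ha h.symm

theorem IsSeparation.sup {r s : Set V × Set V} (hr : IsSeparation G r) (hs : IsSeparation G s) :
    IsSeparation G (s.1 ∪ r.1, s.2 ∩ r.2) where
  finite_inter := (hr.finite_inter.union hs.finite_inter).subset fun v hv => by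
    simp only [Set.mem_inter_iff, Set.mem_union] at *
    tauto
  union_eq := Set.eq_univ_of_forall fun v => by
    have := hr.mem_or v
    have := hs.mem_or v
    simp only [Set.mem_inter_iff, Set.mem_union]
    tauto
  not_adj a ha b hb h := by
    have := hr.mem_or a
    have := hs.mem_or a
    have := hr.mem_or b
    have := hs.mem_or b
    have h1 := hr.not_adj a
    have h2 := hs.not_adj a
    simp only [Set.mem_inter_iff, Set.mem_union, Set.mem_sdiff] at *
    grind

namespace Tangle

variable (τ : Tangle G)

theorem swap_mem_of_notMem {s : Set V × Set V} (hs : IsSeparation G s) (h : s ∉ τ.carrier) :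
    s.swap ∈ τ.carrier :=
  ((τ.orients s hs).or).resolve_left h

theorem snd_infinite {s : Set V × Set V} (hs : s ∈ τ.carrier) : s.2.Infinite := by
  intro hfin
  refine τ.no_star {s} (Set.singleton_subset_iff.2 hs) (Set.finite_singleton s) ?_ (by simpa)
  rintro r rfl q rfl hne
  exact absurd rfl hne

theorem side_infinite {s : Set V × Set V} (hs : s ∈ τ.carrier) : (side s).Infinite := by
  intro hfin
  refine τ.snd_infinite hs ((hfin.union (τ.isSeparation s hs).finite_inter).subset fun v hv => ?_)
  by_cases h : v ∈ s.1
  exacts [.inr ⟨h, hv⟩, .inl ⟨hv, h⟩]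

/-- If the supremum of `r` and `s` were not in `τ`, its inverse would form a star of finite interior
with `s` and with the part of `r` that points towards `s`. -/
theorem sup_mem {r s : Set V × Set V} (hr : r ∈ τ.carrier) (hs : s ∈ τ.carrier) :
    (s.1 ∪ r.1, s.2 ∩ r.2) ∈ τ.carrier := by
  have hrs := τ.isSeparation r hr
  have hss := τ.isSeparation s hs
  have hq := hrs.sup hss
  by_contra hcon
  have hq' := τ.swap_mem_of_notMem hq hcon
  -- This separation is below `r`, so consistency puts it in `τ`, unless its inverse equals `r`; but
  -- then `r.2 ⊆ r.1` would be finite.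
  have hp : (r.1 ∩ s.2, r.2 ∪ s.1) ∈ τ.carrier := by
    have hps : IsSeparation G (r.1 ∩ s.2, r.2 ∪ s.1) := (hss.sup hrs.swap).swap
    by_contra hp
    have hp' := τ.swap_mem_of_notMem hps hp
    refine τ.consistent _ hp' r hr (fun h => ?_)
      ⟨⟨Set.inter_subset_left, Set.subset_union_left⟩, fun h => hp ((congrArg (· ∈ τ.carrier) h).mpr hr)⟩
    have h1 : r.2 ∪ s.1 = r.1 := congrArg Prod.fst h
    exact τ.snd_infinite hr (hrs.finite_inter.subset fun v hv => ⟨h1.le (.inl hv), hv⟩)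
  have h12 : SepLE s (r.1 ∩ s.2, r.2 ∪ s.1).swap :=
    ⟨Set.subset_union_right, Set.inter_subset_right⟩
  have h13 : SepLE s (s.1 ∪ r.1, s.2 ∩ r.2) := ⟨Set.subset_union_left, Set.inter_subset_left⟩
  have h23 : SepLE (r.1 ∩ s.2, r.2 ∪ s.1) (s.1 ∪ r.1, s.2 ∩ r.2) :=
    ⟨fun v hv => .inr hv.1, fun v hv => .inl hv.2⟩
  refine τ.no_star {s, (r.1 ∩ s.2, r.2 ∪ s.1), (s.1 ∪ r.1, s.2 ∩ r.2).swap} ?_ (Set.toFinite _)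
    ?_ ?_
  · rintro q (rfl | rfl | rfl)
    exacts [hs, hp, hq']
  · rintro q (rfl | rfl | rfl) q' (rfl | rfl | rfl) hne
    exacts [absurd rfl hne, h12, h13, h12.symm, absurd rfl hne, h23, h13.symm, h23.symm,
      absurd rfl hne]
  -- A vertex of the interior lies in the separator of `s`, or is outside `s.1` and hence in the
  -- separator of `r`.
  · refine (hrs.finite_inter.union hss.finite_inter).subset fun v hv => ?_
    simp only [Set.mem_insert_iff, Set.mem_singleton_iff, Set.iInter_iInter_eq_or_left,
      Set.iInter_iInter_eq_left, Prod.snd_swap, Set.mem_inter_iff, Set.mem_union] at hv ⊢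
    tauto

theorem nonempty_carrier : Nonempty τ.carrier := by
  have h : IsSeparation G (∅, Set.univ) := ⟨by simp, by simp, by simp⟩
  by_cases h' : ((∅, Set.univ) : Set V × Set V) ∈ τ.carrier
  exacts [⟨⟨_, h'⟩⟩, ⟨⟨_, τ.swap_mem_of_notMem h h'⟩⟩]

theorem side_sup (r s : Set V × Set V) :
    side (s.1 ∪ r.1, s.2 ∩ r.2) = side s ∩ side r := by
  ext v
  simp only [side, Set.mem_sdiff, Set.mem_inter_iff, Set.mem_union]
  tauto

theorem directed_side :
    Directed (· ⊇ ·) fun s : τ.carrier => (side s.1 : Set V) := fun s r =>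
  ⟨⟨_, τ.sup_mem r.2 s.2⟩, (side_sup _ _).le.trans Set.inter_subset_left,
    (side_sup _ _).le.trans Set.inter_subset_right⟩

/-- The points of the Stone-Čech compactification that lie in the closure of the strict big side
of every separation in the tangle. -/
def core : Set (StoneCech (OneComplex G)) :=
  ⋂ s : τ.carrier, clBeta (inducedPart G (side s.1))

theorem directed_inducedPart :
    Directed (· ⊇ ·) fun s : τ.carrier => stoneCechUnit '' inducedPart G (side s.1) := fun s r =>
  (τ.directed_side s r).imp fun _ h =>
    ⟨Set.image_mono (inducedPart_mono h.1), Set.image_mono (inducedPart_mono h.2)⟩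

theorem core_nonempty : τ.core.Nonempty := by
  have := τ.nonempty_carrier
  refine IsCompact.nonempty_iInter_of_directed_nonempty_isCompact_isClosed _ (fun s r =>
    (τ.directed_inducedPart s r).imp fun _ h => ⟨closure_mono h.1, closure_mono h.2⟩) (fun s => ?_)
    (fun s => (isClosed_clBeta _).isCompact) fun s => isClosed_clBeta _
  obtain ⟨v, hv⟩ := (τ.side_infinite s.2).nonempty
  exact ⟨_, subset_closure ⟨vertexPoint G v, (supp_vertexPoint v).le.trans
    (Set.singleton_subset_iff.2 hv), rfl⟩⟩

end Tangle

/-! ### Connectedness of the core -/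

theorem range_edgeMap_subset {U₁ U₂ : Set (OneComplex G)} (h1 : IsOpen U₁) (h2 : IsOpen U₂)
    (hU : Disjoint U₁ U₂) (d : G.Dart) (hd : Set.range (edgeMap G d) ⊆ U₁ ∪ U₂)
    {t : unitInterval} (ht : edgeMap G d t ∈ U₁) : Set.range (edgeMap G d) ⊆ U₁ :=
  IsPreconnected.subset_left_of_subset_union h1 h2 hU hd ⟨_, ⟨t, rfl⟩, ht⟩
    (isPreconnected_range (continuous_edgeMap d))

theorem range_edgeMap_subset_inducedPart {W : Set V} {d : G.Dart} (h1 : d.fst ∈ W)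
    (h2 : d.snd ∈ W) : Set.range (edgeMap G d) ⊆ inducedPart G W := by
  rintro _ ⟨t, rfl⟩
  exact (supp_edgeMap_subset d t).trans (Set.insert_subset h1 (Set.singleton_subset_iff.2 h2))

/-- An edge inside `G[side s]` is connected, so its ends lie in the same `Uᵢ`. Hence only the
separator of `s` joins the vertices in `U₁` to the rest. -/
theorem isSeparation_vertices_mem {U₁ U₂ : Set (OneComplex G)} (h1 : IsOpen U₁) (h2 : IsOpen U₂)
    (hU : Disjoint U₁ U₂) {s : Set V × Set V} (hs : IsSeparation G s)
    (hsub : inducedPart G (side s) ⊆ U₁ ∪ U₂) :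
    IsSeparation G ({v ∈ side s | vertexPoint G v ∈ U₁}ᶜ,
      (s.1 ∩ s.2) ∪ {v ∈ side s | vertexPoint G v ∈ U₁}) where
  finite_inter := hs.finite_inter.subset fun v hv => hv.2.resolve_right hv.1
  union_eq := Set.eq_univ_of_forall fun v => by
    by_cases h : v ∈ {v ∈ side s | vertexPoint G v ∈ U₁}
    exacts [.inr (.inr h), .inl h]
  not_adj := by
    rintro a ⟨ha, ha'⟩ b ⟨hb, hb'⟩ hab
    obtain ⟨hbs, hbU⟩ := not_not.1 hb'
    have has : a ∈ side s := by
      have h3 := hs.not_adj a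
      have h4 := hs.mem_or a
      have h5 : a ∉ s.1 ∩ s.2 := fun h => ha' (.inl h)
      by_contra h6
      simp only [side, Set.mem_sdiff, Set.mem_inter_iff] at *
      exact h3 (by tauto) b hbs hab
    let d : G.Dart := ⟨(b, a), hab.symm⟩
    have hd : Set.range (edgeMap G d) ⊆ inducedPart G (side s) :=
      range_edgeMap_subset_inducedPart hbs has
    refine ha ⟨has, ?_⟩
    rw [show a = d.snd from rfl, ← edgeMap_one]
    exact range_edgeMap_subset h1 h2 hU d (hd.trans hsub) (t := 0)
      (by rw [edgeMap_zero]; exact hbU) ⟨1, rfl⟩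

theorem inducedPart_vertices_mem_subset (hG : ∀ v, ∃ w, G.Adj v w) {U₁ U₂ : Set (OneComplex G)}
    (h1 : IsOpen U₁) (h2 : IsOpen U₂) (hU : Disjoint U₁ U₂) {W : Set V}
    (hsub : inducedPart G W ⊆ U₁ ∪ U₂) :
    inducedPart G {v ∈ W | vertexPoint G v ∈ U₁} ⊆ U₁ := by
  intro p hp
  obtain ⟨d, t, rfl⟩ := exists_eq_edgeMap hG p
  by_cases ht0 : t = 0
  · subst ht0
    rw [edgeMap_zero]
    exact (hp (fst_mem_supp_edgeMap.2 zero_ne_one)).2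
  by_cases ht1 : t = 1
  · subst ht1
    rw [edgeMap_one]
    exact (hp (snd_mem_supp_edgeMap.2 one_ne_zero)).2
  have ha := hp (fst_mem_supp_edgeMap.2 ht1)
  have hb := hp (snd_mem_supp_edgeMap.2 ht0)
  exact range_edgeMap_subset h1 h2 hU d
    ((range_edgeMap_subset_inducedPart ha.1 hb.1).trans hsub) (t := 0)
      (by rw [edgeMap_zero]; exact ha.2) ⟨t, rfl⟩

/-- A splitting of a strict side by disjoint open sets yields two separations. If `τ` pointed away
from both parts, the supremum of these orientations with `s` would have an empty strict side. -/
theorem Tangle.isPreconnected_core (hG : ∀ v, ∃ w, G.Adj v w) (τ : Tangle G) :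
    IsPreconnected τ.core := by
  have := τ.nonempty_carrier
  refine isPreconnected_iInter_closure _ τ.directed_inducedPart ?_
  rintro ⟨s, hs⟩ O₁ O₂ hO₁ hO₂ hO hsub
  have hsub' : inducedPart G (side s) ⊆ stoneCechUnit ⁻¹' O₁ ∪ stoneCechUnit ⁻¹' O₂ :=
    fun p hp => hsub ⟨p, hp, rfl⟩
  have hU₁ := hO₁.preimage (continuous_stoneCechUnit (α := OneComplex G))
  have hU₂ := hO₂.preimage (continuous_stoneCechUnit (α := OneComplex G))
  have hU : Disjoint (stoneCechUnit ⁻¹' O₁ : Set (OneComplex G)) (stoneCechUnit ⁻¹' O₂) :=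
    hO.preimage _
  have hss := τ.isSeparation s hs
  have hq₁ := isSeparation_vertices_mem hU₁ hU₂ hU hss hsub'
  have hsub'' := hsub'.trans (Set.union_comm _ _).le
  have hq₂ := isSeparation_vertices_mem hU₂ hU₁ hU.symm hss hsub''
  have hside : ∀ U : Set (OneComplex G), side ({v ∈ side s | vertexPoint G v ∈ U}ᶜ,
      (s.1 ∩ s.2) ∪ {v ∈ side s | vertexPoint G v ∈ U}) ⊆ {v ∈ side s | vertexPoint G v ∈ U} :=
    fun U v hv => not_not.1 hv.2
  by_cases hm₁ : ({v ∈ side s | vertexPoint G v ∈ stoneCechUnit ⁻¹' O₁}ᶜ,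
      (s.1 ∩ s.2) ∪ {v ∈ side s | vertexPoint G v ∈ stoneCechUnit ⁻¹' O₁}) ∈ τ.carrier
  · exact ⟨⟨_, hm₁⟩, .inl (Set.image_subset_iff.2 ((inducedPart_mono (hside _)).trans
      (inducedPart_vertices_mem_subset hG hU₁ hU₂ hU hsub')))⟩
  by_cases hm₂ : ({v ∈ side s | vertexPoint G v ∈ stoneCechUnit ⁻¹' O₂}ᶜ,
      (s.1 ∩ s.2) ∪ {v ∈ side s | vertexPoint G v ∈ stoneCechUnit ⁻¹' O₂}) ∈ τ.carrier
  · exact ⟨⟨_, hm₂⟩, .inr (Set.image_subset_iff.2 ((inducedPart_mono (hside _)).trans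
      (inducedPart_vertices_mem_subset hG hU₂ hU₁ hU.symm hsub'')))⟩
  exfalso
  have hm₁' := τ.swap_mem_of_notMem hq₁ hm₁
  have hm₂' := τ.swap_mem_of_notMem hq₂ hm₂
  obtain ⟨v, hv⟩ := (τ.side_infinite (τ.sup_mem hm₁' (τ.sup_mem hm₂' hs))).nonempty
  rw [side_sup, side_sup] at hv
  obtain ⟨⟨hv, hv₂⟩, hv₁⟩ := hv
  rcases hsub' (show vertexPoint G v ∈ inducedPart G (side s) from
    (supp_vertexPoint v).le.trans (Set.singleton_subset_iff.2 hv)) with h | h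
  · exact hv₁.2 (.inr ⟨hv, h⟩)
  · exact hv₂.2 (.inr ⟨hv, h⟩)

/-! ## The two remainders -/

theorem unit_notMem_remainder (p : OneComplex G) : stoneCechUnit p ∉ remainder G :=
  fun h => h ⟨p, rfl⟩

theorem notMem_clBeta_of_isCompact {A : Set (OneComplex G)} (hA : IsCompact A)
    {x : StoneCech (OneComplex G)} (hx : x ∈ remainder G) : x ∉ clBeta A := by
  rw [clBeta_of_isCompact hA]
  rintro ⟨p, -, rfl⟩
  exact unit_notMem_remainder p hx

theorem auxRemainder_subset_remainder (hG : ∀ v, ∃ w, G.Adj v w) :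
    auxRemainder G ⊆ remainder G := by
  rintro x hx ⟨p, rfl⟩
  obtain ⟨v, hv⟩ := supp_nonempty p
  refine hx (Set.mem_iUnion.2 ⟨v, subset_closure ⟨p, mem_closedStar hG hv, rfl⟩, fun h => ?_⟩)
  obtain ⟨w, hw, rfl⟩ := (mem_clBeta_unit hG (isClosed_image_vertexPoint _)).1 h
  rw [supp_vertexPoint] at hv
  obtain rfl : v = w := hv
  exact G.irrefl hw

theorem mem_neighbourPoints_of_mem_auxRemainder {x : StoneCech (OneComplex G)}
    (hx : x ∈ auxRemainder G) {v : V} (hv : x ∈ clBeta (closedStar G v)) :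
    x ∈ clBeta (neighbourPoints G v) := by
  by_contra h
  exact hx (Set.mem_iUnion.2 ⟨v, hv, h⟩)

theorem clBeta_biUnion {ι : Type*} {X : Set ι} (hX : X.Finite) (A : ι → Set (OneComplex G)) :
    clBeta (⋃ i ∈ X, A i) = ⋃ i ∈ X, clBeta (A i) := by
  simp only [clBeta, Set.image_iUnion]
  exact hX.closure_biUnion _

/-- Every point of the auxiliary remainder lies on one of the strict sides of a separation. -/
theorem mem_clBeta_side_or (hG : ∀ v, ∃ w, G.Adj v w) {x : StoneCech (OneComplex G)}
    (hx : x ∈ auxRemainder G) {s : Set V × Set V} (hs : IsSeparation G s) :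
    x ∈ clBeta (inducedPart G (side s)) ∨ x ∈ clBeta (inducedPart G (side s.swap)) := by
  have hfin := notMem_clBeta_of_isCompact (isCompact_inducedPart hG hs.finite_inter)
    (auxRemainder_subset_remainder hG hx)
  have hV : ∀ v, v ∈ (s.1 ∩ s.2) ∪ (side s ∪ side s.swap) := fun v => by
    have := hs.mem_or v
    simp only [side, Set.mem_union, Set.mem_inter_iff, Set.mem_sdiff, Prod.fst_swap, Prod.snd_swap]
    tauto
  -- A point of the 1-complex outside both strict sides has a separator vertex in its support.
  have hcov : (Set.univ : Set (OneComplex G)) ⊆ (⋃ v ∈ s.1 ∩ s.2, closedStar G v) ∪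
      (inducedPart G (side s) ∪ inducedPart G (side s.swap)) := by
    intro p _
    by_cases h : ∃ v ∈ s.1 ∩ s.2, v ∈ p.supp
    · obtain ⟨v, hvX, hv⟩ := h
      exact .inl (Set.mem_biUnion hvX (mem_closedStar hG hv))
    push Not at h
    right
    obtain ⟨u, hu⟩ := supp_nonempty p
    have hX : ∀ w ∈ p.supp, w ∈ side s ∨ w ∈ side s.swap := fun w hw =>
      (hV w).resolve_left fun h' => h w h' hw
    have h1 := (inducedPart_union_of_isSeparation hG hs).ge (Set.mem_univ p)
    rcases h1 with h1 | h1
    · exact .inr fun w hw => (hX w hw).resolve_left fun h2 => h2.2 (h1 hw)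
    · exact .inl fun w hw => (hX w hw).resolve_right fun h2 => h2.2 (h1 hw)
  have hx' := clBeta_mono hcov (clBeta_univ.ge (Set.mem_univ x))
  rw [clBeta_union, clBeta_union, clBeta_biUnion hs.finite_inter] at hx'
  rcases hx' with hx' | hx'
  · obtain ⟨v, -, hv⟩ := Set.mem_iUnion₂.1 hx'
    -- In the auxiliary remainder the star of `v` can be replaced by the neighbours of `v`. These
    -- are vertices, so no edge between separator and side intervenes.
    have hN : neighbourPoints G v ⊆ inducedPart G (s.1 ∩ s.2) ∪
        (inducedPart G (side s) ∪ inducedPart G (side s.swap)) := by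
      rintro _ ⟨w, -, rfl⟩
      have hw : ∀ W : Set V, w ∈ W → vertexPoint G w ∈ inducedPart G W := fun W h =>
        (supp_vertexPoint w).le.trans (Set.singleton_subset_iff.2 h)
      exact (hV w).imp (hw _) (Or.imp (hw _) (hw _))
    have h2 := clBeta_mono hN (mem_neighbourPoints_of_mem_auxRemainder hx hv)
    rw [clBeta_union, clBeta_union] at h2
    exact h2.resolve_left hfin
  · exact hx'

theorem disjoint_side {r s : Set V × Set V} (h : r.1 ⊆ s.1) : Disjoint (side r.swap) (side s) :=
  Set.disjoint_left.2 fun _ h1 h2 => h2.2 (h h1.1)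

theorem disjoint_clBeta_inducedPart (hG : ∀ v, ∃ w, G.Adj v w) {W W' : Set V}
    (h : Disjoint W W') : Disjoint (clBeta (inducedPart G W)) (clBeta (inducedPart G W')) :=
  disjoint_clBeta hG (isClosed_inducedPart _) (isClosed_inducedPart _) (disjoint_inducedPart h)

/-- The tangle of all separations whose big side has a given point of the auxiliary remainder in
its closure. -/
def tangleOf (hG : ∀ v, ∃ w, G.Adj v w) (x : StoneCech (OneComplex G)) (hx : x ∈ auxRemainder G) :
    Tangle G where
  carrier := {s | IsSeparation G s ∧ x ∈ clBeta (inducedPart G (side s))}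
  isSeparation s hs := hs.1
  orients s hs := by
    have hd := Set.disjoint_left.1 (disjoint_clBeta_inducedPart hG
      (disjoint_side (r := s) (s := s) subset_rfl))
    rcases mem_clBeta_side_or hG hx hs with h | h
    · exact .inl ⟨⟨hs, h⟩, fun h' => hd h'.2 h⟩
    · exact .inr ⟨⟨hs.swap, h⟩, fun h' => hd h h'.2⟩
  consistent r hr s hs _ h :=
    Set.disjoint_left.1 (disjoint_clBeta_inducedPart hG
      (disjoint_side (r := r.swap) (s := s) h.1.1)) hr.2 hs.2
  no_star σ hσ hfin hstar hcon := by
    -- Closures commute with finite intersections, so `x` lies in the closure of the part induced by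
    -- the interior; that part is compact if the interior is finite.
    have key : x ∈ clBeta (inducedPart G (⋂ s ∈ σ, s.2)) := by
      clear hcon hstar
      induction σ, hfin using Set.Finite.induction_on with
      | empty =>
        have : inducedPart G (⋂ s ∈ (∅ : Set (Set V × Set V)), s.2) = Set.univ := by
          simp [inducedPart]
        rw [this, clBeta_univ]
        trivial
      | @insert s σ _ _ ih =>
        rw [Set.biInter_insert, inducedPart_inter, clBeta_inter hG (isClosed_inducedPart _)
          (isClosed_inducedPart _)]
        exact ⟨clBeta_mono (inducedPart_mono Set.sdiff_subset) (hσ (Set.mem_insert _ _)).2,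
          ih ((Set.subset_insert _ _).trans hσ)⟩
    exact notMem_clBeta_of_isCompact (isCompact_inducedPart hG hcon)
      (auxRemainder_subset_remainder hG hx) key

/-- The tangle contains `({v}, V)`, so the core lies in the closure of `G - v`, which meets the
closed star at `v` only in neighbours of `v`. -/
theorem Tangle.core_subset_auxRemainder (hG : ∀ v, ∃ w, G.Adj v w) (τ : Tangle G) :
    τ.core ⊆ auxRemainder G := by
  intro x hx hcon
  obtain ⟨v, hv, hv'⟩ := Set.mem_iUnion.1 hcon
  have hs : IsSeparation G ({v}, Set.univ) := ⟨by simp, by simp, by simp⟩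
  have hsτ : (({v}, Set.univ) : Set V × Set V) ∈ τ.carrier := by
    by_contra h
    exact τ.snd_infinite (τ.swap_mem_of_notMem hs h) (Set.finite_singleton v)
  have h1 := Set.mem_iInter.1 hx ⟨_, hsτ⟩
  refine hv' (clBeta_mono ?_ ((clBeta_inter hG (isClosed_closedStar v)
    (isClosed_inducedPart _)).ge ⟨hv, h1⟩))
  rintro p ⟨⟨w, hvw, hp⟩, hp'⟩
  have : p.supp ⊆ {w} := fun u hu => (hp hu).resolve_left (hp' hu).2
  exact ⟨w, hvw, (eq_vertexPoint_of_supp_subset this).symm⟩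

theorem mem_core_tangleOf (hG : ∀ v, ∃ w, G.Adj v w) {x : StoneCech (OneComplex G)}
    (hx : x ∈ auxRemainder G) : x ∈ (tangleOf hG x hx).core :=
  Set.mem_iInter.2 fun s => s.2.2

theorem Tangle.eq_of_carrier_subset {σ τ : Tangle G} (h : σ.carrier ⊆ τ.carrier) : σ = τ := by
  refine Tangle.ext (h.antisymm fun s hs => ?_)
  have hss := τ.isSeparation s hs
  by_contra h'
  rcases τ.orients s hss with h1 | h1
  · exact h1.2 (h (σ.swap_mem_of_notMem hss h'))
  · exact h1.2 hs

theorem Tangle.eq_of_mem_core (hG : ∀ v, ∃ w, G.Adj v w) {σ τ : Tangle G}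
    {x : StoneCech (OneComplex G)} (hσ : x ∈ σ.core) (hτ : x ∈ τ.core) : σ = τ := by
  refine Tangle.eq_of_carrier_subset fun s hs => ?_
  by_contra h
  have h1 := τ.swap_mem_of_notMem (σ.isSeparation s hs) h
  exact Set.disjoint_left.1 (disjoint_clBeta_inducedPart hG
      (disjoint_side (r := s) (s := s) subset_rfl))
    (Set.mem_iInter.1 hτ ⟨_, h1⟩) (Set.mem_iInter.1 hσ ⟨s, hs⟩)

/-- A connected set of the auxiliary remainder that meets the core of a tangle lies inside it. -/
theorem Tangle.subset_core (hG : ∀ v, ∃ w, G.Adj v w) (τ : Tangle G)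
    {T : Set (StoneCech (OneComplex G))} (hT : IsPreconnected T) (hTsub : T ⊆ auxRemainder G)
    (h : (T ∩ τ.core).Nonempty) : T ⊆ τ.core := by
  refine Set.subset_iInter fun ⟨s, hs⟩ => ?_
  have hd := disjoint_clBeta_inducedPart hG (disjoint_side (r := s) (s := s) subset_rfl)
  have hor := (isPreconnected_closed_iff.1 hT) (clBeta (inducedPart G (side s)))
    (clBeta (inducedPart G (side s.swap))) (isClosed_clBeta _) (isClosed_clBeta _)
    fun x hx => mem_clBeta_side_or hG (hTsub hx) (τ.isSeparation s hs)
  intro x hx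
  refine (mem_clBeta_side_or hG (hTsub hx) (τ.isSeparation s hs)).resolve_right fun h' => ?_
  obtain ⟨y, hyT, hy⟩ := h
  obtain ⟨z, -, hz1, hz2⟩ := hor ⟨y, hyT, Set.mem_iInter.1 hy ⟨s, hs⟩⟩ ⟨x, hx, h'⟩
  exact Set.disjoint_left.1 hd hz2 hz1

/-- A connected set of the remainder that meets the closure of a side of a separation lies in
that closure. -/
theorem subset_clBeta_of_isPreconnected (hG : ∀ v, ∃ w, G.Adj v w)
    {T : Set (StoneCech (OneComplex G))} (hT : IsPreconnected T) (hTsub : T ⊆ remainder G)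
    {s : Set V × Set V} (hs : IsSeparation G s)
    (h : (T ∩ clBeta (inducedPart G s.2)).Nonempty) : T ⊆ clBeta (inducedPart G s.2) := by
  have hcov : T ⊆ clBeta (inducedPart G s.2) ∪ clBeta (inducedPart G s.1) := by
    rw [← clBeta_union, Set.union_comm, inducedPart_union_of_isSeparation hG hs, clBeta_univ]
    exact Set.subset_univ _
  intro x hx
  refine (hcov hx).resolve_right fun h' => ?_
  obtain ⟨z, hzT, hz2, hz1⟩ := (isPreconnected_closed_iff.1 hT) _ _ (isClosed_clBeta _)
    (isClosed_clBeta _) hcov h ⟨x, hx, h'⟩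
  -- The two closures meet in the closure of the compact part induced by the separator.
  refine notMem_clBeta_of_isCompact (isCompact_inducedPart hG hs.finite_inter) (hTsub hzT) ?_
  rw [inducedPart_inter, clBeta_inter hG (isClosed_inducedPart _) (isClosed_inducedPart _)]
  exact ⟨hz1, hz2⟩

/-! ## Components of the Stone-Čech remainder meet the auxiliary remainder -/

/-- The union of the closed edges `vw`, `w ∈ S`, each truncated to the points whose coordinate at
`w` is at least `c w`. -/
def truncatedStar (G : SimpleGraph V) (v : V) (c : V → ℝ) (S : Set V) : Set (OneComplex G) :=
  {p | ∃ w ∈ S, G.Adj v w ∧ p.supp ⊆ {v, w} ∧ c w ≤ p.1 w}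

theorem exists_eq_edgeMap_of_supp_subset {v w : V} (hvw : G.Adj v w) {p : OneComplex G}
    (hp : p.supp ⊆ {v, w}) : ∃ t, p = edgeMap G ⟨(v, w), hvw⟩ t := by
  have hvert : ∀ u, (vertexPoint G u).supp ⊆ {v, w} →
      ∃ t, vertexPoint G u = edgeMap G ⟨(v, w), hvw⟩ t := by
    intro u hu
    rw [supp_vertexPoint, Set.singleton_subset_iff] at hu
    rcases hu with rfl | rfl
    exacts [⟨0, (edgeMap_zero ⟨(_, _), hvw⟩).symm⟩, ⟨1, (edgeMap_one ⟨(_, _), hvw⟩).symm⟩]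
  obtain ⟨f, ⟨a, rfl⟩ | ⟨a, b, hab, t, ht, rfl⟩⟩ := p
  · exact hvert a hp
  · change ∃ r, edgeMap G ⟨(a, b), hab⟩ ⟨t, ht⟩ = _
    change (edgeMap G ⟨(a, b), hab⟩ ⟨t, ht⟩).supp ⊆ _ at hp
    generalize (⟨t, ht⟩ : unitInterval) = r at hp ⊢
    by_cases h0 : r = 0
    · rw [h0, edgeMap_zero] at hp ⊢
      exact hvert _ hp
    by_cases h1 : r = 1
    · rw [h1, edgeMap_one] at hp ⊢
      exact hvert _ hp
    have ha : a ∈ ({v, w} : Set V) := hp (fst_mem_supp_edgeMap.2 h1)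
    have hb : b ∈ ({v, w} : Set V) := hp (snd_mem_supp_edgeMap.2 h0)
    rcases ha with rfl | rfl <;> rcases hb with rfl | rfl
    · exact absurd rfl hab.ne
    · exact ⟨r, rfl⟩
    · exact ⟨_, edgeMap_symm ⟨(b, a), hvw⟩ r⟩
    · exact absurd rfl hab.ne

section TruncatedStar

variable {v : V} {c : V → ℝ}

theorem edgeMap_mem_truncatedStar (hc : ∀ w, 0 < c w) {S : Set V} {d : G.Dart} (hd : d.fst = v)
    {t : unitInterval} : edgeMap G d t ∈ truncatedStar G v c S ↔ d.snd ∈ S ∧ c d.snd ≤ t := by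
  constructor
  · rintro ⟨w, hwS, hvw, hsupp, hw⟩
    have hws : w ∈ (edgeMap G d t).supp := ((hc w).trans_le hw).ne'
    have hwd : w = d.snd :=
      (supp_edgeMap_subset d t hws).resolve_left fun h => hvw.ne (hd.symm.trans h.symm)
    subst hwd
    rw [edgeMap_apply_snd] at hw
    exact ⟨hwS, hw⟩
  · rintro ⟨h1, h2⟩
    exact ⟨d.snd, h1, hd ▸ d.adj, hd ▸ supp_edgeMap_subset d t, by rwa [edgeMap_apply_snd]⟩

theorem truncatedStar_eq_iUnion (hc : ∀ w, 0 < c w) (S : Set V) : truncatedStar G v c S =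
    ⋃ d ∈ {d : G.Dart | d.fst = v ∧ d.snd ∈ S},
      edgeMap G d '' {t | c d.snd ≤ (t : ℝ)} := by
  ext p
  constructor
  · rintro ⟨w, hwS, hvw, hsupp, hw⟩
    let d : G.Dart := ⟨(v, w), hvw⟩
    refine Set.mem_biUnion (x := d) ⟨rfl, hwS⟩ ?_
    obtain ⟨t, rfl⟩ := exists_eq_edgeMap_of_supp_subset hvw hsupp
    exact ⟨t, hw.trans (edgeMap_apply_snd d t).le, rfl⟩
  · intro hp
    obtain ⟨d, ⟨hd, hdS⟩, t, ht, rfl⟩ := Set.mem_iUnion₂.1 hp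
    exact (edgeMap_mem_truncatedStar hc hd).2 ⟨hdS, ht⟩

theorem isClosed_truncatedStar (hc : ∀ w, 0 < c w) (S : Set V) :
    IsClosed (truncatedStar G v c S) := by
  have key : ∀ d : G.Dart, d.fst = v → IsClosed (edgeMap G d ⁻¹' truncatedStar G v c S) := by
    intro d hd
    have : edgeMap G d ⁻¹' truncatedStar G v c S =
        {t : unitInterval | d.snd ∈ S ∧ c d.snd ≤ (t : ℝ)} :=
      Set.ext fun t => edgeMap_mem_truncatedStar hc hd
    rw [this]
    exact isClosed_const.inter (isClosed_le continuous_const continuous_subtype_val)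
  refine isClosed_iff.2 fun d => ?_
  by_cases h1 : d.fst = v
  · exact key d h1
  by_cases h2 : d.snd = v
  · have h3 := (key d.symm h2).preimage unitInterval.continuous_symm
    rw [← Set.preimage_comp] at h3
    have : edgeMap G d.symm ∘ unitInterval.symm = edgeMap G d :=
      funext fun t => by rw [Function.comp, edgeMap_symm, unitInterval.symm_symm]
    rwa [this] at h3
  · refine ((Set.toFinite {0, 1}).subset ?_).isClosed
    rintro t ⟨w, -, -, h, -⟩
    exact trace_subset_of_notMem h1 h2 h

/-- Positivity of `c` cuts off the centre, so distinct truncated edges are disjoint. -/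
theorem truncatedStar_inter (hc : ∀ w, 0 < c w) (S T : Set V) :
    truncatedStar G v c (S ∩ T) = truncatedStar G v c S ∩ truncatedStar G v c T := by
  ext p
  constructor
  · rintro ⟨w, hw, h⟩
    exact ⟨⟨w, hw.1, h⟩, ⟨w, hw.2, h⟩⟩
  · rintro ⟨⟨w, hw, h⟩, ⟨u, hu, h'⟩⟩
    have hwp : w ∈ p.supp := ((hc w).trans_le h.2.2).ne'
    obtain rfl : w = u := (h'.2.1 hwp).resolve_left h.1.ne'
    exact ⟨w, ⟨hw, hu⟩, h⟩

theorem truncatedStar_union (S T : Set V) :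
    truncatedStar G v c (S ∪ T) = truncatedStar G v c S ∪ truncatedStar G v c T := by
  ext p
  constructor
  · rintro ⟨w, hw | hw, h⟩
    exacts [.inl ⟨w, hw, h⟩, .inr ⟨w, hw, h⟩]
  · rintro (⟨w, hw, h⟩ | ⟨w, hw, h⟩)
    exacts [⟨w, .inl hw, h⟩, ⟨w, .inr hw, h⟩]

theorem isPreconnected_truncatedStar_singleton (hc : ∀ w, 0 < c w) (w : V) :
    IsPreconnected (truncatedStar G v c {w}) := by
  by_cases hvw : G.Adj v w
  · let d : G.Dart := ⟨(v, w), hvw⟩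
    have : {d : G.Dart | d.fst = v ∧ d.snd ∈ ({w} : Set V)} = {d} := by
      ext e
      constructor
      · rintro ⟨h1, h2⟩
        exact SimpleGraph.Dart.ext _ _ (Prod.ext h1 h2)
      · rintro rfl
        exact ⟨rfl, rfl⟩
    rw [truncatedStar_eq_iUnion hc, this, Set.biUnion_singleton]
    refine IsPreconnected.image ?_ _ (continuous_edgeMap d).continuousOn
    have : Set.OrdConnected {t : unitInterval | c d.snd ≤ (t : ℝ)} :=
      ⟨fun a ha b _ t ht => le_trans ha (Subtype.coe_le_coe.2 ht.1)⟩
    exact this.isPreconnected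
  · have : truncatedStar G v c {w} = ∅ := by
      refine Set.eq_empty_of_forall_notMem ?_
      rintro p ⟨u, rfl, h, -⟩
      exact hvw h
    rw [this]
    exact isPreconnected_empty

end TruncatedStar

/-- A neighbourhood of the centre of a star contains everything but a truncated star. -/
theorem exists_closedStar_subset {v : V} {U : Set (OneComplex G)} (hU : IsOpen U)
    (hv : vertexPoint G v ∈ U) :
    ∃ c : V → ℝ, (∀ w, 0 < c w) ∧ (∀ w, c w ≤ 1) ∧
      closedStar G v ⊆ U ∪ truncatedStar G v c Set.univ := by
  have hex : ∀ w, ∃ ε : ℝ, 0 < ε ∧ ε ≤ 1 ∧ ∀ h : G.Adj v w, ∀ t : unitInterval,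
      (t : ℝ) < ε → edgeMap G ⟨(v, w), h⟩ t ∈ U := by
    intro w
    by_cases h : G.Adj v w
    · have h1 := isOpen_iff.1 hU ⟨(v, w), h⟩
      have h2 : (0 : unitInterval) ∈ edgeMap G ⟨(v, w), h⟩ ⁻¹' U := by
        change edgeMap G ⟨(v, w), h⟩ 0 ∈ U
        rwa [edgeMap_zero]
      obtain ⟨ε, hε, hsub⟩ := Metric.isOpen_iff.1 h1 0 h2
      -- The bound 1 keeps the far end `w` in the truncated edge.
      refine ⟨min ε 1, lt_min hε one_pos, min_le_right _ _, fun _ t ht => hsub ?_⟩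
      rw [Metric.mem_ball, Subtype.dist_eq, Real.dist_eq]
      have h0 : ((0 : unitInterval) : ℝ) = 0 := rfl
      rw [h0, sub_zero, abs_of_nonneg t.2.1]
      exact ht.trans_le (min_le_left _ _)
    · exact ⟨1, one_pos, le_rfl, fun h' => absurd h' h⟩
  choose c hc0 hc1 hc using hex
  refine ⟨c, hc0, hc1, ?_⟩
  rintro p ⟨w, hvw, hp⟩
  obtain ⟨t, rfl⟩ := exists_eq_edgeMap_of_supp_subset hvw hp
  rcases lt_or_ge (t : ℝ) (c w) with h | h
  · exact .inl (hc w hvw t h)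
  · exact .inr ⟨w, trivial, hvw, hp, (edgeMap_apply_snd ⟨(v, w), hvw⟩ t).symm ▸ h⟩

theorem truncatedStar_singleton_subset (v : V) (c : V → ℝ) (w : V) :
    truncatedStar G v c {w} ⊆ inducedPart G {v, w} := by
  rintro p ⟨u, rfl, -, h, -⟩
  exact h

theorem truncatedStar_mono {v : V} {c : V → ℝ} {S T : Set V} (h : S ⊆ T) :
    truncatedStar G v c S ⊆ truncatedStar G v c T := by
  rintro p ⟨w, hw, hp⟩
  exact ⟨w, h hw, hp⟩

/-- A vertex in the closed star at `w` is `w` itself or a neighbour of `w`, and the closure of a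
single point misses the remainder. -/
theorem mem_auxRemainder_of_mem_clBeta_neighbourPoints (hG : ∀ v, ∃ w, G.Adj v w) {v : V}
    {x : StoneCech (OneComplex G)} (hx : x ∈ remainder G) (hv : x ∈ clBeta (neighbourPoints G v)) :
    x ∈ auxRemainder G := by
  intro hcon
  obtain ⟨w, hw, hw'⟩ := Set.mem_iUnion.1 hcon
  have h1 := (clBeta_inter hG (isClosed_image_vertexPoint _) (isClosed_closedStar w)).ge ⟨hv, hw⟩
  have hsub : neighbourPoints G v ∩ closedStar G w ⊆ neighbourPoints G w ∪ inducedPart G {w} := by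
    rintro _ ⟨⟨u, -, rfl⟩, u', hu', h⟩
    rw [supp_vertexPoint, Set.singleton_subset_iff] at h
    rcases h with rfl | rfl
    · exact .inr (supp_vertexPoint _).le
    · exact .inl ⟨_, hu', rfl⟩
  have h2 := clBeta_mono hsub h1
  rw [clBeta_union] at h2
  exact h2.elim hw' (notMem_clBeta_of_isCompact
    (isCompact_inducedPart hG (Set.finite_singleton w)) hx)

/-- Every point outside the auxiliary remainder can be connected to it in the remainder. -/
theorem exists_isPreconnected_of_mem_closedStar (hG : ∀ v, ∃ w, G.Adj v w) {v : V}
    {x : StoneCech (OneComplex G)} (hx : x ∈ remainder G) (hv : x ∈ clBeta (closedStar G v)) :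
    ∃ T ⊆ remainder G, IsPreconnected T ∧ x ∈ T ∧ (T ∩ auxRemainder G).Nonempty := by
  have hne : x ≠ stoneCechUnit (vertexPoint G v) := fun h => hx ⟨_, h.symm⟩
  obtain ⟨O₁, O₂, hO₁, hO₂, hx₁, hv₂, hO⟩ := t2_separation hne
  obtain ⟨c, hc0, hc1, hsub⟩ := exists_closedStar_subset
    (hO₂.preimage (continuous_stoneCechUnit (α := OneComplex G))) hv₂
  have hxA : x ∈ clBeta (truncatedStar G v c Set.univ) := by
    have := clBeta_mono hsub hv
    rw [clBeta_union] at this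
    refine this.resolve_left fun h => ?_
    exact Set.disjoint_left.1 (hO.closure_right hO₁) hx₁
      (closure_mono (Set.image_preimage_subset _ _) h)
  -- An ultrafilter on the vertices. The intersection of the closures of its truncated stars is the
  -- connected set sought.
  let u : Set (Set V) := {S | x ∈ clBeta (truncatedStar G v c S)}
  have hu_inter : ∀ S ∈ u, ∀ T ∈ u, S ∩ T ∈ u := by
    intro S hS T hT
    change x ∈ clBeta _
    rw [truncatedStar_inter hc0, clBeta_inter hG (isClosed_truncatedStar hc0 _)
      (isClosed_truncatedStar hc0 _)]
    exact ⟨hS, hT⟩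
  have hu_split : ∀ S T, S ∪ T ∈ u → S ∈ u ∨ T ∈ u := by
    intro S T h
    change x ∈ clBeta _ at h
    rwa [truncatedStar_union, clBeta_union] at h
  have : Nonempty u := ⟨⟨_, hxA⟩⟩
  let F : u → Set (StoneCech (OneComplex G)) := fun S => stoneCechUnit '' truncatedStar G v c S.1
  have hdir : Directed (· ⊇ ·) F := fun S T => ⟨⟨_, hu_inter S.1 S.2 T.1 T.2⟩,
    Set.image_mono (truncatedStar_mono Set.inter_subset_left),
    Set.image_mono (truncatedStar_mono Set.inter_subset_right)⟩
  have hconn : IsPreconnected (⋂ S, closure (F S)) := by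
    refine isPreconnected_iInter_closure F hdir ?_
    -- Each truncated edge is connected, so it lies in `P₁` or in `P₂`. This splits `S`, and `u`
    -- contains one of the parts.
    rintro ⟨S, hS⟩ P₁ P₂ hP₁ hP₂ hP hsubP
    let S₁ : Set V := {w ∈ S | stoneCechUnit '' truncatedStar G v c {w} ⊆ P₁}
    let S₂ : Set V := {w ∈ S | stoneCechUnit '' truncatedStar G v c {w} ⊆ P₂}
    have hS₁₂ : S₁ ∪ S₂ ∈ u := by
      refine clBeta_mono (truncatedStar_mono fun w hw => ?_) hS
      have h1 := ((isPreconnected_truncatedStar_singleton (G := G) (v := v) hc0 w).image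
        stoneCechUnit continuous_stoneCechUnit.continuousOn)
      exact (h1.subset_or_subset hP₁ hP₂ hP ((Set.image_mono (truncatedStar_mono
        (Set.singleton_subset_iff.2 hw))).trans hsubP)).imp (⟨hw, ·⟩) (⟨hw, ·⟩)
    have hmem : ∀ P : Set (StoneCech (OneComplex G)), stoneCechUnit '' truncatedStar G v c
        {w ∈ S | stoneCechUnit '' truncatedStar G v c {w} ⊆ P} ⊆ P := by
      rintro P _ ⟨p, ⟨w, hw, hp⟩, rfl⟩
      exact hw.2 ⟨p, ⟨w, rfl, hp⟩, rfl⟩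
    rcases hu_split _ _ hS₁₂ with h | h
    exacts [⟨⟨_, h⟩, .inl (hmem P₁)⟩, ⟨⟨_, h⟩, .inr (hmem P₂)⟩]
  have hrem : (⋂ S, closure (F S)) ⊆ remainder G := by
    rintro y hy ⟨p, rfl⟩
    have hp : ∀ S ∈ u, p ∈ truncatedStar G v c S := fun S hS =>
      (mem_clBeta_unit hG (isClosed_truncatedStar hc0 S)).1 (Set.mem_iInter.1 hy ⟨S, hS⟩)
    obtain ⟨w, -, hw⟩ := hp _ hxA
    -- A single edge is compact, so `u` is free along edges and no point of the 1-complex survives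
    -- the intersection.
    have hwu : {w} ∉ u := fun h => notMem_clBeta_of_isCompact
      (isCompact_inducedPart hG (Set.toFinite {v, w})) hx
      (clBeta_mono (truncatedStar_singleton_subset v c w) h)
    have h1 : ({w}ᶜ : Set V) ∈ u :=
      (hu_split {w} {w}ᶜ (by rw [Set.union_compl_self]; exact hxA)).resolve_left hwu
    obtain ⟨w', hw', -⟩ := (truncatedStar_inter hc0 {w} {w}ᶜ).ge ⟨⟨w, rfl, hw⟩, hp _ h1⟩
    exact hw'.2 hw'.1
  refine ⟨_, hrem, hconn, Set.mem_iInter.2 fun S => S.2, ?_⟩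
  -- The far ends of the truncated edges supply a point near the neighbours of `v`, by compactness.
  have hN : (⋂ S : u, clBeta (vertexPoint G '' (G.neighborSet v ∩ S.1))).Nonempty := by
    refine IsCompact.nonempty_iInter_of_directed_nonempty_isCompact_isClosed _ (fun S T =>
      ⟨⟨_, hu_inter S.1 S.2 T.1 T.2⟩, clBeta_mono (Set.image_mono fun w hw => ⟨hw.1, hw.2.1⟩),
        clBeta_mono (Set.image_mono fun w hw => ⟨hw.1, hw.2.2⟩)⟩) ?_
      (fun S => (isClosed_clBeta _).isCompact) fun S => isClosed_clBeta _
    rintro ⟨S, hS⟩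
    obtain ⟨_, p, ⟨w, hw, hvw, -⟩, -⟩ := closure_nonempty_iff.1 ⟨x, hS⟩
    exact ⟨_, subset_closure ⟨_, ⟨w, ⟨hvw, hw⟩, rfl⟩, rfl⟩⟩
  obtain ⟨y, hy⟩ := hN
  have hyT : y ∈ ⋂ S, closure (F S) := by
    refine Set.mem_iInter.2 fun S => clBeta_mono ?_ (Set.mem_iInter.1 hy S)
    rintro _ ⟨w, ⟨hvw, hw⟩, rfl⟩
    refine ⟨w, hw, hvw, (supp_vertexPoint w).le.trans (by simp), ?_⟩
    simpa [vertexPoint] using hc1 w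
  refine ⟨y, hyT, mem_auxRemainder_of_mem_clBeta_neighbourPoints hG (hrem hyT)
    (clBeta_mono (Set.image_mono Set.inter_subset_left) (Set.mem_iInter.1 hy ⟨_, hxA⟩))⟩

theorem exists_isPreconnected_of_mem_remainder (hG : ∀ v, ∃ w, G.Adj v w)
    {x : StoneCech (OneComplex G)} (hx : x ∈ remainder G) :
    ∃ T ⊆ remainder G, IsPreconnected T ∧ x ∈ T ∧ (T ∩ auxRemainder G).Nonempty := by
  by_cases h : x ∈ auxRemainder G
  · exact ⟨{x}, Set.singleton_subset_iff.2 hx, isPreconnected_singleton, rfl, x, rfl, h⟩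
  · obtain ⟨v, hv, -⟩ := Set.mem_iUnion.1 (not_not.1 h)
    exact exists_isPreconnected_of_mem_closedStar hG hx hv

/-! ## Separations as sets of components -/

theorem side_sepTo {X : Set V} (𝒞 : Set (G.ComponentCompl X)) :
    side (sepTo 𝒞) = vertexUnion 𝒞 := by
  ext v
  simp only [side, sepTo, Set.mem_sdiff, Set.mem_union, Set.mem_compl_iff, not_not]
  tauto

theorem vertexUnion_univ (X : Set V) :
    vertexUnion (Set.univ : Set (G.ComponentCompl X)) = Xᶜ := by
  ext v
  refine ⟨fun h hX => Set.disjoint_left.1 (disjoint_vertexUnion _) hX h, fun h => ?_⟩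
  exact Set.mem_biUnion (Set.mem_univ (G.componentComplMk h)) (G.componentComplMk_mem h)

theorem vertexUnion_union_compl {X : Set V} (𝒞 : Set (G.ComponentCompl X)) :
    vertexUnion 𝒞 ∪ vertexUnion 𝒞ᶜ = Xᶜ := by
  rw [← vertexUnion_univ (G := G), ← Set.union_compl_self 𝒞, vertexUnion, vertexUnion,
    vertexUnion, Set.biUnion_union]

/-- A component of `G - (A ∩ B)` that meets `B \ A` stays inside it, as a walk avoiding the
separator cannot cross. -/
theorem IsSeparation.exists_sepTo {s : Set V × Set V} (hs : IsSeparation G s) {X : Set V}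
    (hX : X = s.1 ∩ s.2) : ∃ 𝒞 : Set (G.ComponentCompl X), sepTo 𝒞 = s := by
  subst hX
  have hcl : ∀ (C : G.ComponentCompl (s.1 ∩ s.2)), ((C : Set V) ∩ side s).Nonempty →
      (C : Set V) ⊆ side s := by
    rintro C ⟨v, hvC, hvs⟩ w hw
    obtain ⟨hvX, rfl⟩ := hvC
    obtain ⟨hwX, hvw⟩ := hw
    have hreach := SimpleGraph.ConnectedComponent.exact hvw.symm
    obtain ⟨p⟩ := hreach
    have : ∀ (a b : ((s.1 ∩ s.2)ᶜ : Set V)) (_ : (G.induce (s.1 ∩ s.2)ᶜ).Walk a b),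
        a.1 ∈ side s → b.1 ∈ side s := by
      intro a b p
      induction p with
      | nil => exact id
      | @cons a b _ hab _ ih =>
        intro ha
        refine ih ?_
        by_contra hb
        have h1 := hs.mem_or b.1
        have h2 : b.1 ∉ s.1 ∩ s.2 := b.2
        have hb' : b.1 ∈ s.1 \ s.2 := by
          simp only [side, Set.mem_sdiff, Set.mem_inter_iff] at *
          tauto
        exact hs.not_adj _ hb' _ ha (SimpleGraph.Adj.symm hab)
    exact this _ _ p hvs
  have hV : vertexUnion {C : G.ComponentCompl (s.1 ∩ s.2) | (C : Set V) ⊆ side s} = side s := by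
    ext v
    constructor
    · intro h
      obtain ⟨C, hC, hv⟩ := Set.mem_iUnion₂.1 h
      exact hC hv
    · intro h
      have hvX : v ∉ s.1 ∩ s.2 := fun h' => h.2 h'.1
      exact Set.mem_biUnion (hcl _ ⟨v, G.componentComplMk_mem hvX, h⟩) (G.componentComplMk_mem hvX)
  refine ⟨{C | (C : Set V) ⊆ side s}, Prod.ext ?_ ?_⟩
  · change (vertexUnion _)ᶜ = s.1
    rw [hV]
    ext v
    have := hs.mem_or v
    simp only [side, Set.mem_sdiff, Set.mem_compl_iff]
    tauto
  · change (s.1 ∩ s.2) ∪ vertexUnion _ = s.2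
    rw [hV]
    ext v
    simp only [side, Set.mem_sdiff, Set.mem_union, Set.mem_inter_iff]
    tauto

theorem nonempty_of_vertexUnion {X : Set V} {𝒞 : Set (G.ComponentCompl X)}
    (h : (vertexUnion 𝒞).Nonempty) : 𝒞.Nonempty := by
  obtain ⟨v, hv⟩ := h
  obtain ⟨C, hC, -⟩ := Set.mem_iUnion₂.1 hv
  exact ⟨C, hC⟩

theorem Tangle.bigClass_eq (τ : Tangle G) (γ : Gamma G) {𝒞 : Set (G.ComponentCompl (γ.X : Set V))}
    (h1 : 𝒞 ∈ γ.P) (h2 : sepTo 𝒞 ∈ τ.carrier) : τ.bigClass γ = 𝒞 :=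
  (τ.existsUnique_class γ).unique (τ.bigClass_spec γ) ⟨h1, h2⟩

/-- If both strict sides are infinite, deleting the separator and sorting the components by side
gives a pair in `Γ'`. If `A \ B` is finite, so is `A`; then `X = A` with a single class has the same
strict big side. -/
theorem Tangle.exists_bigClass_eq_side (τ : Tangle G) {s : Set V × Set V} (hs : s ∈ τ.carrier) :
    ∃ γ ∈ Gamma.infinitary G, vertexUnion (τ.bigClass γ) = side s := by
  have hss := τ.isSeparation s hs
  have hinf := τ.side_infinite hs
  by_cases hfin : (side s.swap).Finite
  · have h1 : s.1.Finite := (hfin.union hss.finite_inter).subset fun v hv => by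
      by_cases h : v ∈ s.2
      exacts [.inr ⟨hv, h⟩, .inl ⟨hv, h⟩]
    have hside : vertexUnion (Set.univ : Set (G.ComponentCompl (h1.toFinset : Set V))) = side s := by
      rw [vertexUnion_univ, h1.coe_toFinset]
      ext v
      have := hss.mem_or v
      simp only [side, Set.mem_sdiff, Set.mem_compl_iff]
      tauto
    have hne : (Set.univ : Set (G.ComponentCompl (h1.toFinset : Set V))).Nonempty :=
      nonempty_of_vertexUnion (hside ▸ hinf.nonempty)
    let γ : Gamma G := ⟨h1.toFinset, {Set.univ}, Set.finite_singleton _,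
      fun h => hne.ne_empty h.symm,
      fun C => ⟨Set.univ, ⟨rfl, trivial⟩, fun D hD => hD.1⟩⟩
    refine ⟨γ, ?_, ?_⟩
    · rintro 𝒞 rfl
      exact hside ▸ hinf
    · have : τ.bigClass γ = Set.univ := (τ.bigClass_spec γ).1
      rw [this]
      exact hside
  · have hX : (hss.finite_inter.toFinset : Set V) = s.1 ∩ s.2 := hss.finite_inter.coe_toFinset
    obtain ⟨𝒞, h𝒞⟩ := hss.exists_sepTo hX
    have h1 : vertexUnion 𝒞 = side s := by rw [← side_sepTo, h𝒞]
    have h2 : vertexUnion 𝒞ᶜ = side s.swap := by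
      have h3 := (vertexUnion_union_compl 𝒞).trans (congrArg compl hX)
      have h4 := vertexUnion_disjoint (disjoint_compl_right (a := 𝒞))
      rw [h1] at h3 h4
      ext v
      have h5 := hss.mem_or v
      have h6 := Set.ext_iff.1 h3 v
      have h7 : ¬ (v ∈ side s ∧ v ∈ vertexUnion 𝒞ᶜ) := fun h => Set.disjoint_left.1 h4 h.1 h.2
      simp only [side, Set.mem_sdiff, Set.mem_compl_iff, Set.mem_union, Set.mem_inter_iff,
        Prod.fst_swap, Prod.snd_swap] at *
      tauto
    have hne1 : 𝒞.Nonempty := nonempty_of_vertexUnion (h1 ▸ hinf.nonempty)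
    have hne2 : 𝒞ᶜ.Nonempty :=
      nonempty_of_vertexUnion (h2 ▸ Set.Infinite.nonempty hfin)
    let γ : Gamma G := ⟨hss.finite_inter.toFinset, {𝒞, 𝒞ᶜ}, Set.toFinite _, by
      rintro (h | h)
      exacts [hne1.ne_empty h.symm, hne2.ne_empty h.symm], fun C => by
      by_cases hC : C ∈ 𝒞
      · refine ⟨𝒞, ⟨.inl rfl, hC⟩, ?_⟩
        rintro _ ⟨rfl | rfl, h⟩
        exacts [rfl, absurd hC h]
      · refine ⟨𝒞ᶜ, ⟨.inr rfl, hC⟩, ?_⟩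
        rintro _ ⟨rfl | rfl, h⟩
        exacts [absurd h hC, rfl]⟩
    refine ⟨γ, ?_, ?_⟩
    · intro 𝒟 h𝒟
      rcases h𝒟 with h | h
      · exact (congrArg vertexUnion h).trans h1 ▸ hinf
      · exact (congrArg vertexUnion h).trans h2 ▸ hfin
    · rw [τ.bigClass_eq γ (𝒞 := 𝒞) (.inl rfl) (h𝒞 ▸ hs)]
      exact h1

/-! ## The components corresponding to a tangle -/

theorem Tangle.core_eq_iInter (hG : ∀ v, ∃ w, G.Adj v w) (τ : Tangle G) {Δ : Set (Gamma G)}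
    (hΔ : Gamma.infinitary G ⊆ Δ) :
    τ.core = ⋂ γ ∈ Δ, clBeta (componentUnion (τ.bigClass γ)) := by
  simp only [componentUnion_eq_inducedPart hG]
  apply Set.Subset.antisymm
  · refine Set.subset_iInter₂ fun γ _ => ?_
    rw [← side_sepTo]
    exact Set.iInter_subset_of_subset ⟨_, (τ.bigClass_spec γ).2⟩ subset_rfl
  · refine Set.subset_iInter fun ⟨s, hs⟩ => ?_
    obtain ⟨γ, hγ, h⟩ := τ.exists_bigClass_eq_side hs
    rw [← h]
    exact Set.biInter_subset_of_mem (hΔ hγ)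

theorem Tangle.core_eq_auxRemainder_inter (hG : ∀ v, ∃ w, G.Adj v w) (τ : Tangle G)
    {Δ : Set (Gamma G)} (hΔ : Gamma.infinitary G ⊆ Δ) :
    τ.core = auxRemainder G ∩ ⋂ γ ∈ Δ, clBeta (τ.bigPart γ) := by
  apply Set.Subset.antisymm
  · refine Set.subset_inter (τ.core_subset_auxRemainder hG) ?_
    rw [τ.core_eq_iInter hG hΔ]
    simp only [componentUnion_eq_inducedPart hG]
    exact Set.iInter₂_mono fun γ _ => clBeta_mono (inducedPart_mono Set.subset_union_right)
  · rintro x ⟨hx, hx'⟩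
    refine Set.mem_iInter.2 fun ⟨s, hs⟩ => ?_
    obtain ⟨γ, hγ, h⟩ := τ.exists_bigClass_eq_side hs
    have hxγ := Set.mem_iInter₂.1 hx' γ (hΔ hγ)
    -- The alternative side avoids `X ∪ V[𝒞]`, so its closure is disjoint from that of the big part.
    have hor := mem_clBeta_side_or hG hx (isSeparation_sepTo γ.X.finite_toSet (τ.bigClass γ))
    rw [side_sepTo, h] at hor
    refine hor.resolve_right fun h' => ?_
    refine Set.disjoint_left.1 (disjoint_clBeta_inducedPart hG ?_) h' hxγ
    exact Set.disjoint_left.2 fun v hv => hv.2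

/-- The intersection of the remainder with the closures of the big parts of a tangle. -/
def Tangle.outerCore (τ : Tangle G) (Δ : Set (Gamma G)) : Set (StoneCech (OneComplex G)) :=
  remainder G ∩ ⋂ γ ∈ Δ, clBeta (τ.bigPart γ)

theorem Tangle.core_subset_remainder (hG : ∀ v, ∃ w, G.Adj v w) (τ : Tangle G) :
    τ.core ⊆ remainder G :=
  (τ.core_subset_auxRemainder hG).trans (auxRemainder_subset_remainder hG)

theorem Tangle.core_subset_outerCore (hG : ∀ v, ∃ w, G.Adj v w) (τ : Tangle G)
    {Δ : Set (Gamma G)} (hΔ : Gamma.infinitary G ⊆ Δ) : τ.core ⊆ τ.outerCore Δ :=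
  Set.subset_inter (τ.core_subset_remainder hG)
    ((τ.core_eq_auxRemainder_inter hG hΔ).le.trans Set.inter_subset_right)

theorem Tangle.subset_outerCore (hG : ∀ v, ∃ w, G.Adj v w) (τ : Tangle G) {Δ : Set (Gamma G)}
    {T : Set (StoneCech (OneComplex G))} (hT : IsPreconnected T) (hTsub : T ⊆ remainder G)
    (h : (T ∩ τ.outerCore Δ).Nonempty) : T ⊆ τ.outerCore Δ := by
  refine Set.subset_inter hTsub (Set.subset_iInter₂ fun γ hγ => ?_)
  obtain ⟨y, hyT, -, hy⟩ := h
  exact subset_clBeta_of_isPreconnected hG hT hTsub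
    (isSeparation_sepTo γ.X.finite_toSet (τ.bigClass γ)) ⟨y, hyT, Set.mem_iInter₂.1 hy γ hγ⟩

theorem Tangle.connectedComponentIn_auxRemainder (hG : ∀ v, ∃ w, G.Adj v w) (τ : Tangle G)
    {x : StoneCech (OneComplex G)} (hx : x ∈ τ.core) :
    connectedComponentIn (auxRemainder G) x = τ.core := by
  have hsub := τ.core_subset_auxRemainder hG
  refine Set.Subset.antisymm ?_ ((τ.isPreconnected_core hG).subset_connectedComponentIn hx hsub)
  exact τ.subset_core hG isPreconnected_connectedComponentIn (connectedComponentIn_subset _ _)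
    ⟨x, mem_connectedComponentIn (hsub hx), hx⟩

/-- The outer core is connected through the core: any of its points is joined to the auxiliary
remainder by a connected set, which cannot leave the outer core and so ends in the core. -/
theorem Tangle.connectedComponentIn_remainder (hG : ∀ v, ∃ w, G.Adj v w) (τ : Tangle G)
    {Δ : Set (Gamma G)} (hΔ : Gamma.infinitary G ⊆ Δ) {x : StoneCech (OneComplex G)}
    (hx : x ∈ τ.core) : connectedComponentIn (remainder G) x = τ.outerCore Δ := by
  have hsub := τ.core_subset_remainder hG
  apply Set.Subset.antisymm
  · exact τ.subset_outerCore hG isPreconnected_connectedComponentIn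
      (connectedComponentIn_subset _ _)
      ⟨x, mem_connectedComponentIn (hsub hx), τ.core_subset_outerCore hG hΔ hx⟩
  · intro y hy
    obtain ⟨T, hTsub, hT, hyT, z, hzT, hz⟩ := exists_isPreconnected_of_mem_remainder hG hy.1
    have hzτ : z ∈ τ.core := by
      rw [τ.core_eq_auxRemainder_inter hG hΔ]
      exact ⟨hz, (τ.subset_outerCore hG hT hTsub ⟨y, hyT, hy⟩ hzT).2⟩
    refine (hT.union z hzT hzτ (τ.isPreconnected_core hG)).subset_connectedComponentIn (.inr hx)
      (Set.union_subset hTsub hsub) (.inl hyT)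

theorem Tangle.auxCorresponds_iff (hG : ∀ v, ∃ w, G.Adj v w) (τ : Tangle G)
    {K : Set (StoneCech (OneComplex G))} : τ.AuxCorresponds K ↔ K = τ.core := by
  constructor
  · rintro ⟨⟨x, hx, rfl⟩, h⟩
    refine (τ.connectedComponentIn_auxRemainder hG ?_)
    rw [τ.core_eq_iInter hG (Set.subset_univ _)]
    exact Set.mem_iInter₂.2 fun γ _ =>
      (h x (mem_connectedComponentIn hx) γ _ (τ.bigClass_spec γ).1).2 rfl
  · rintro rfl
    obtain ⟨x, hx⟩ := τ.core_nonempty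
    refine ⟨⟨x, τ.core_subset_auxRemainder hG hx,
      (τ.connectedComponentIn_auxRemainder hG hx).symm⟩, ?_⟩
    intro y hy γ 𝒞 h𝒞
    rw [τ.core_eq_iInter hG (Set.subset_univ _)] at hy
    have hyγ := Set.mem_iInter₂.1 hy γ trivial
    constructor
    · intro hy𝒞
      by_contra hne
      rw [componentUnion_eq_inducedPart hG] at hyγ hy𝒞
      exact Set.disjoint_left.1 (disjoint_clBeta_inducedPart hG (vertexUnion_disjoint
        (γ.isPartition.pairwiseDisjoint h𝒞 (τ.bigClass_spec γ).1 hne))) hy𝒞 hyγ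
    · rintro rfl
      exact hyγ

theorem Tangle.corresponds_iff (hG : ∀ v, ∃ w, G.Adj v w) (τ : Tangle G) {Δ : Set (Gamma G)}
    (hΔ : Gamma.infinitary G ⊆ Δ) {L : Set (StoneCech (OneComplex G))} :
    τ.Corresponds L ↔ L = τ.outerCore Δ := by
  obtain ⟨x, hx⟩ := τ.core_nonempty
  have hxr := τ.core_subset_remainder hG hx
  rw [← τ.connectedComponentIn_remainder hG hΔ hx]
  constructor
  · rintro ⟨⟨y, hy, rfl⟩, K, hK, hKL⟩
    rw [τ.auxCorresponds_iff hG] at hK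
    subst hK
    exact connectedComponentIn_eq (hKL hx)
  · rintro rfl
    exact ⟨⟨x, hxr, rfl⟩, τ.core, (τ.auxCorresponds_iff hG).2 rfl,
      (τ.isPreconnected_core hG).subset_connectedComponentIn hx (τ.core_subset_remainder hG)⟩

theorem Tangle.core_eq_outerCore_inter (hG : ∀ v, ∃ w, G.Adj v w) (τ : Tangle G)
    {Δ : Set (Gamma G)} (hΔ : Gamma.infinitary G ⊆ Δ) :
    τ.core = τ.outerCore Δ ∩ auxRemainder G := by
  apply Set.Subset.antisymm
  · exact Set.subset_inter (τ.core_subset_outerCore hG hΔ) (τ.core_subset_auxRemainder hG)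
  · rintro x ⟨⟨-, hx⟩, hx'⟩
    rw [τ.core_eq_auxRemainder_inter hG hΔ]
    exact ⟨hx', hx⟩

end StoneTangle

/-! ### The correspondences and the formulas -/

theorem theorem5p24 {V : Type u} [Infinite V] (G : SimpleGraph V) (hG : G.Connected) :
    -- the correspondences between tangles and components are one-to-one
    (∀ τ : StoneTangle.Tangle G, ∃! L, τ.Corresponds L) ∧
    (∀ L, StoneTangle.IsComponentOf (StoneTangle.remainder G) L →
      ∃! τ : StoneTangle.Tangle G, τ.Corresponds L) ∧
    (∀ τ : StoneTangle.Tangle G, ∃! K, τ.AuxCorresponds K) ∧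
    (∀ K, StoneTangle.IsComponentOf (StoneTangle.auxRemainder G) K →
      ∃! τ : StoneTangle.Tangle G, τ.AuxCorresponds K) ∧
    -- the formulas for the corresponding components; `Δ` is `Γ` or its subset `Γ'`
    (∀ (τ : StoneTangle.Tangle G) (τstar τtimes : Set (StoneCech (StoneTangle.OneComplex G))),
      τ.Corresponds τstar → τ.AuxCorresponds τtimes →
      ∀ Δ : Set (StoneTangle.Gamma G),
        (Δ = Set.univ ∨ Δ = StoneTangle.Gamma.infinitary G) →
        τstar = StoneTangle.remainder G ∩
          ⋂ γ ∈ Δ, StoneTangle.clBeta (τ.bigPart γ) ∧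
        τtimes = ⋂ γ ∈ Δ, StoneTangle.clBeta (StoneTangle.componentUnion (τ.bigClass γ)) ∧
        τtimes = StoneTangle.auxRemainder G ∩
          ⋂ γ ∈ Δ, StoneTangle.clBeta (τ.bigPart γ) ∧
        τtimes = τstar ∩ StoneTangle.auxRemainder G) := by
  have hadj : ∀ v, ∃ w, G.Adj v w := hG.preconnected.exists_adj_of_nontrivial
  have hcor := fun τ : StoneTangle.Tangle G => fun L =>
    τ.corresponds_iff hadj (Set.subset_univ _) (L := L)
  refine ⟨fun τ => ⟨_, (hcor τ _).2 rfl, fun L hL => (hcor τ L).1 hL⟩, ?_,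
    fun τ => ⟨_, (τ.auxCorresponds_iff hadj).2 rfl, fun K hK => (τ.auxCorresponds_iff hadj).1 hK⟩,
    ?_, ?_⟩
  · rintro L ⟨x, hx, rfl⟩
    -- The component meets the auxiliary remainder in some `z`, and the tangle of `z` is the one
    -- sought. It is unique because the core of any corresponding tangle is the trace of `L` on the
    -- auxiliary remainder and hence contains `z`.
    obtain ⟨T, hTsub, hT, hxT, z, hzT, hz⟩ :=
      StoneTangle.exists_isPreconnected_of_mem_remainder hadj hx
    have hzL := hT.subset_connectedComponentIn hxT hTsub hzT
    have hzc := StoneTangle.mem_core_tangleOf hadj hz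
    refine ⟨StoneTangle.tangleOf hadj z hz, ?_, fun τ hτ => ?_⟩
    · refine (hcor _ _).2 ?_
      rw [connectedComponentIn_eq hzL]
      exact StoneTangle.Tangle.connectedComponentIn_remainder hadj _ (Set.subset_univ _) hzc
    · refine StoneTangle.Tangle.eq_of_mem_core hadj (x := z) ?_ hzc
      rw [τ.core_eq_outerCore_inter hadj (Set.subset_univ _), ← (hcor τ _).1 hτ]
      exact ⟨hzL, hz⟩
  · rintro K ⟨x, hx, rfl⟩
    have hxc := StoneTangle.mem_core_tangleOf hadj hx
    refine ⟨StoneTangle.tangleOf hadj x hx, ?_, fun τ hτ => ?_⟩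
    · refine (StoneTangle.Tangle.auxCorresponds_iff hadj _).2 ?_
      exact StoneTangle.Tangle.connectedComponentIn_auxRemainder hadj _ hxc
    · refine StoneTangle.Tangle.eq_of_mem_core hadj (x := x) ?_ hxc
      rw [← (τ.auxCorresponds_iff hadj).1 hτ]
      exact mem_connectedComponentIn hx
  · intro τ τstar τtimes hstar htimes Δ hΔ
    have hΔ' : StoneTangle.Gamma.infinitary G ⊆ Δ := by
      rcases hΔ with rfl | rfl
      exacts [Set.subset_univ _, subset_rfl]
    obtain rfl := (τ.corresponds_iff hadj hΔ').1 hstar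
    obtain rfl := (τ.auxCorresponds_iff hadj).1 htimes
    exact ⟨rfl, τ.core_eq_iInter hadj hΔ', τ.core_eq_auxRemainder_inter hadj hΔ',
      τ.core_eq_outerCore_inter hadj hΔ'⟩
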